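/- Let $M$ be a compact complex manifold of dimension $n$ with a Kähler metric $g$ (a smooth Riemannian metric $g$ with $g(JX,JY)=g(X,Y)$ whose fundamental $2$-form $g(X,JY)$ is closed), and write $g_{a\bar b}=g(\partial_a,\partial_{\bar b})$ for its components in local holomorphic coordinates $z^1,\dots,z^n$ ($g$ extended $\mathbb C$-bilinearly, $\partial_a=\partial/\partial z^a$, $\partial_{\bar b}=\partial/\partial\bar z^b$) and $(g^{\bar e f})=(g_{f\bar e})^{-1}$. Suppose that the curvature tensor of $g$ vanishes, i.e. in all local holomorphic coordinates $$R_{a\bar bc\bar d}=\partial_c\partial_{\bar d}\,g_{a\bar b}-\sum_{e,f}g^{\bar f e}\,\partial_c g_{a\bar f}\,\partial_{\bar d}g_{e\bar b}=0 .$$ Then $(M,g)$ is a Hermitian (Kähler-)Frobenius manifold; that is, there exist on $M$: 1. a holomorphic affine structure: an atlas of holomorphic charts whose coordinate changes are complex affine transformations; 2. a smooth flat torsionless affine connection $\nabla_0$ on the tangent bundle which is the connection of this affine structure (the coordinate vector fields of affine coordinates are $\nabla_0$-flat) and is compatible with $g$, i.e. $\nabla_0 g=0$; 3. a commutative and associative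 multiplication $\circ$ on the tangent sheaf ($\mathbb C$-bilinear on each tangent space and depending holomorphically on the point) which is induced by $\nabla_0$: $X\circ Y=(\nabla_0)_XY$ for all local $\nabla_0$-flat vector fields $X,Y$; 4. a symmetric tensor $A$ of rank three with $A(X,Y,Z)=g(X\circ Y,Z)=g(X,Y\circ Z)$; 5. locally near every point, a smooth real potential $\Phi$ with $g_{a\bar b}=\partial_a\partial_{\bar b}\Phi$ in all holomorphic coordinates, such that in the affine coordinates of 1, with $\Phi_{ab\bar c}=\partial_a\partial_b\partial_{\bar c}\Phi$ and so on, one has $A(\partial_a,\partial_b,\partial_{\bar c})=\Phi_{ab\bar c}$ and the Hermitian WDVV equation $$\sum_{e,f}\Phi_{ab\bar e}\,g^{\bar e f}\,\Phi_{f\bar c\bar d}=\sum_{e,f}\Phi_{b\bar c\bar e}\,g^{\bar e f}\,\Phi_{fa\bar d}\qquad\text{for all }a,b,c,d .$$ -/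

import Mathlib

open scoped Manifold ContDiff Topology Bundle

noncomputable section

namespace KahlerFrobenius

/-- The model space `ℂⁿ` with coordinates `z¹, …, zⁿ`. -/
abbrev Cn (n : ℕ) : Type := Fin n → ℂ

/-- A complex manifold is, with the same charts, a real analytic (in particular smooth) manifold. -/
instance isManifold_real {n : ℕ} {M : Type*} [TopologicalSpace M] [ChartedSpace (Cn n) M]
    [IsManifold 𝓘(ℂ, Cn n) ω M] : IsManifold 𝓘(ℝ, Cn n) ω M := by
  refine isManifold_of_contDiffOn _ _ _ fun e e' he he' => ?_
  have h := (contDiffGroupoid ω 𝓘(ℂ, Cn n)).compatible he he'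
  rw [contDiffGroupoid, mem_groupoid_of_pregroupoid] at h
  exact ContDiffOn.restrict_scalars ℝ h.1

section Defs

variable {n : ℕ} {M : Type*} [TopologicalSpace M] [ChartedSpace (Cn n) M]

variable (n M) in
/-- Local holomorphic coordinate systems of the complex manifold `M`. -/
def holomorphicCharts : Set (OpenPartialHomeomorph M (Cn n)) :=
  IsManifold.maximalAtlas 𝓘(ℂ, Cn n) ω M

/-- The real tangent space of `M` at `x`. -/
abbrev T (n : ℕ) {M : Type*} [TopologicalSpace M] [ChartedSpace (Cn n) M] (x : M) : Type :=
  TangentSpace 𝓘(ℝ, Cn n) x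

/-- The complex structure of `M`: multiplication by `i` on each tangent space. -/
def J (x : M) : T n x →L[ℝ] T n x :=
  (Complex.I • ContinuousLinearMap.id ℝ (Cn n) : Cn n →L[ℝ] Cn n)

/-- The coordinate vector field on the domain of `φ` with constant coordinate vector `v`. -/
def coordField (φ : OpenPartialHomeomorph M (Cn n)) (v : Cn n) (x : M) : T n x :=
  VectorField.mpullback 𝓘(ℝ, Cn n) 𝓘(ℝ, Cn n) φ (fun _ => v) x

/-! ### Complex coordinate vectors and Wirtinger derivatives -/

/-- The value of (the complex linear extension of) a real linear `L` on
`(v - i J v) / 2`, the part of type `(1,0)` of `v`. -/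
def holPart {n : ℕ} (L : Cn n → ℂ) (v : Cn n) : ℂ := (L v - Complex.I * L (Complex.I • v)) / 2

/-- The value of (the complex linear extension of) a real linear `L` on
`(v + i J v) / 2`, the part of type `(0,1)` of `v`. -/
def antiPart {n : ℕ} (L : Cn n → ℂ) (v : Cn n) : ℂ := (L v + Complex.I * L (Complex.I • v)) / 2

/-- The real coordinate vector `∂/∂xᵃ`, where `zᵃ = xᵃ + i yᵃ`. -/
def e {n : ℕ} (a : Fin n) : Cn n := Pi.single a 1

/-- `∂f/∂zᵃ`. -/
def dz {n : ℕ} (a : Fin n) (f : Cn n → ℂ) (z : Cn n) : ℂ := holPart (fun u => fderiv ℝ f z u) (e a)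

/-- `∂f/∂z̄ᵃ`. -/
def dzbar {n : ℕ} (a : Fin n) (f : Cn n → ℂ) (z : Cn n) : ℂ :=
  antiPart (fun u => fderiv ℝ f z u) (e a)

section Manifold

variable [IsManifold 𝓘(ℂ, Cn n) ω M]

/-! ### Kähler metrics -/

variable (n M) in
/-- Smooth Riemannian metrics on `M`. -/
abbrev Metric : Type _ :=
  Bundle.ContMDiffRiemannianMetric 𝓘(ℝ, Cn n) ∞ (Cn n) (fun x : M => T n x)

/-- The fundamental 2-form `g(X, J Y)`, in the coordinates `φ`. -/
def fundamentalForm (g : Metric n M) (φ : OpenPartialHomeomorph M (Cn n)) (u v : Cn n)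
    (z : Cn n) : ℝ :=
  g.inner (φ.symm z) (coordField φ u (φ.symm z)) (J (φ.symm z) (coordField φ v (φ.symm z)))

/-- `g` is a Kähler metric: it is Hermitian and its fundamental 2-form is closed. -/
structure IsKahler (g : Metric n M) : Prop where
  hermitian : ∀ (x : M) (X Y : T n x), g.inner x (J x X) (J x Y) = g.inner x X Y
  closed : ∀ φ ∈ holomorphicCharts n M, ∀ z ∈ φ.target, ∀ u v w : Cn n,
    fderiv ℝ (fundamentalForm g φ v w) z u - fderiv ℝ (fundamentalForm g φ u w) z v
      + fderiv ℝ (fundamentalForm g φ u v) z w = 0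

/-- The components `g_{a b̄} = g(∂/∂zᵃ, ∂/∂z̄ᵇ)` in the coordinates `φ`, where `g` is extended
complex bilinearly. -/
def metricMatrix (g : Metric n M) (φ : OpenPartialHomeomorph M (Cn n)) (z : Cn n) :
    Matrix (Fin n) (Fin n) ℂ :=
  Matrix.of fun a b =>
    holPart (fun u => antiPart (fun v =>
      (g.inner (φ.symm z) (coordField φ u (φ.symm z)) (coordField φ v (φ.symm z)) : ℂ))
      (e b)) (e a)

/-- The curvature tensor of a Kähler metric in the coordinates `φ`,
`R_{a b̄ c d̄} = ∂_c ∂_d̄ g_{a b̄} - ∑ g^{f̄ e} ∂_c g_{a f̄} ∂_d̄ g_{e b̄}`,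
with `(g^{f̄ e})` the inverse of the matrix `(g_{e f̄})`. -/
def curvature (g : Metric n M) (φ : OpenPartialHomeomorph M (Cn n)) (a b c d : Fin n)
    (z : Cn n) : ℂ :=
  dz c (dzbar d fun y => metricMatrix g φ y a b) z
    - ∑ k, ∑ f, (metricMatrix g φ z)⁻¹ f k *
        dz c (fun y => metricMatrix g φ y a f) z * dzbar d (fun y => metricMatrix g φ y k b) z

/-- The curvature tensor vanishes. -/
def HasVanishingCurvature (g : Metric n M) : Prop :=
  ∀ φ ∈ holomorphicCharts n M, ∀ z ∈ φ.target, ∀ a b c d : Fin n, curvature g φ a b c d z = 0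

/-! ### Affine connections and holomorphic affine structures -/

variable (n M) in
/-- Affine connections on (the real tangent bundle of) `M`. The derivative `∇_X Y` at `x` is
written `cov Y x (X x)`. -/
abbrev Connection : Type _ :=
  CovariantDerivative 𝓘(ℝ, Cn n) (Cn n) (fun x : M => T n x)

/-- The vector field `X` is differentiable at `x`. -/
def DiffFieldAt (X : ∀ x : M, T n x) (x : M) : Prop :=
  MDifferentiableAt 𝓘(ℝ, Cn n) (𝓘(ℝ, Cn n).prod 𝓘(ℝ, Cn n))
    (fun y => (⟨y, X y⟩ : TangentBundle 𝓘(ℝ, Cn n) M)) x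

/-- The vector field `X` is smooth on `U`. -/
def SmoothFieldOn (X : ∀ x : M, T n x) (U : Set M) : Prop :=
  ContMDiffOn 𝓘(ℝ, Cn n) (𝓘(ℝ, Cn n).prod 𝓘(ℝ, Cn n)) ∞
    (fun y => (⟨y, X y⟩ : TangentBundle 𝓘(ℝ, Cn n) M)) U

/-- The vector field `X` is flat (parallel) for `cov` on `U`. -/
def IsFlatFieldOn (cov : Connection n M) (X : ∀ x : M, T n x) (U : Set M) : Prop :=
  ∀ x ∈ U, DiffFieldAt X x ∧ cov X x = 0

/-- The connection is flat:
`∇_X ∇_Y Z - ∇_Y ∇_X Z - ∇_[X,Y] Z = 0` for all smooth local vector fields. -/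
def IsFlatConnection (cov : Connection n M) : Prop :=
  ∀ (U : Set M) (X Y Z : ∀ x : M, T n x), IsOpen U →
    SmoothFieldOn X U → SmoothFieldOn Y U → SmoothFieldOn Z U → ∀ x ∈ U,
      cov (fun y => cov Z y (Y y)) x (X x) - cov (fun y => cov Z y (X y)) x (Y x)
        - cov Z x (VectorField.mlieBracket 𝓘(ℝ, Cn n) X Y x) = 0

/-- The connection is compatible with the metric:
`V (g(X, Y)) = g(∇_V X, Y) + g(X, ∇_V Y)`. -/
def IsCompatible (g : Metric n M) (cov : Connection n M) : Prop :=
  ∀ (x : M) (V : T n x) (X Y : ∀ y : M, T n y), DiffFieldAt X x → DiffFieldAt Y x →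
    mvfderiv 𝓘(ℝ, Cn n) (fun y => g.inner y (X y) (Y y)) x V
      = g.inner x (cov X x V) (Y x) + g.inner x (X x) (cov Y x V)

variable (n M) in
/-- A holomorphic affine structure: an atlas of holomorphic charts whose coordinate changes are
(restrictions of) complex affine transformations. -/
structure HolomorphicAffineStructure where
  charts : Set (OpenPartialHomeomorph M (Cn n))
  holomorphic : charts ⊆ holomorphicCharts n M
  cover : ∀ x : M, ∃ φ ∈ charts, x ∈ φ.source
  affine_change : ∀ φ ∈ charts, ∀ ψ ∈ charts, ∃ L : Cn n ≃ᵃ[ℂ] Cn n,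
    ∀ x ∈ φ.source ∩ ψ.source, ψ x = L (φ x)

/-! ### Potentials and the Hermitian WDVV equation -/

/-- A real function read in the coordinates `φ`, as a complex valued function. -/
def inChart (φ : OpenPartialHomeomorph M (Cn n)) (F : M → ℝ) (z : Cn n) : ℂ := (F (φ.symm z) : ℂ)

/-- `F` is a real smooth potential of `g` on `U`: in all holomorphic coordinates
`g_{a b̄} = ∂²F / ∂zᵃ ∂z̄ᵇ`. -/
structure IsPotentialOn (g : Metric n M) (F : M → ℝ) (U : Set M) : Prop where
  smooth : ContMDiffOn 𝓘(ℝ, Cn n) 𝓘(ℝ, ℝ) ∞ F U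
  metric_eq : ∀ φ ∈ holomorphicCharts n M, ∀ z ∈ φ.target, φ.symm z ∈ U → ∀ a b : Fin n,
    metricMatrix g φ z a b = dz a (dzbar b (inChart φ F)) z

/-- The Hermitian WDVV equation for `F` at the point with coordinates `z`, in the coordinates `φ`:
`∑ F_{a b ē} g^{ē f} F_{f c̄ d̄} = ∑ F_{b c̄ ē} g^{ē f} F_{f a d̄}` for all `a, b, c̄, d̄`. -/
def HermitianWDVVAt (g : Metric n M) (F : M → ℝ) (φ : OpenPartialHomeomorph M (Cn n))
    (z : Cn n) : Prop :=
  ∀ a b c d : Fin n,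
    ∑ k, ∑ f, dz a (dz b (dzbar k (inChart φ F))) z * (metricMatrix g φ z)⁻¹ k f *
        dz f (dzbar c (dzbar d (inChart φ F))) z
    = ∑ k, ∑ f, dz b (dzbar c (dzbar k (inChart φ F))) z * (metricMatrix g φ z)⁻¹ k f *
        dz f (dz a (dzbar d (inChart φ F))) z

/-! ### Hermitian Frobenius manifolds -/

/-- The structure of a Hermitian Frobenius manifold on the complex manifold `M` with metric `g`. -/
structure HermitianFrobeniusStructure (g : Metric n M) where
  /-- a Kähler metric -/
  kahler : IsKahler g
  /-- a holomorphic affine structure -/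
  affine : HolomorphicAffineStructure n M
  /-- a smooth flat torsionless affine connection, the one of the affine structure
  (affine coordinate vector fields are flat), compatible with the metric -/
  cov : Connection n M
  cov_smooth : CovariantDerivative.ContMDiffCovariantDerivative cov ∞
  cov_flat : IsFlatConnection cov
  cov_torsion : cov.torsion = 0
  cov_compatible : IsCompatible g cov
  cov_affine : ∀ φ ∈ affine.charts, ∀ v : Cn n, IsFlatFieldOn cov (coordField φ v) φ.source
  /-- a multiplication on the tangent sheaf: complex bilinear, depending holomorphically on the
  point (in particular smoothly) -/
  mul : ∀ x : M, T n x →L[ℝ] T n x →L[ℝ] T n x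
  mul_J : ∀ (x : M) (X Y : T n x), mul x (J x X) Y = J x (mul x X Y)
  mul_holomorphic : ∀ φ ∈ holomorphicCharts n M, ∀ u v : Cn n, DifferentiableOn ℂ
    (fun z : Cn n => (mfderiv 𝓘(ℝ, Cn n) 𝓘(ℝ, Cn n) φ (φ.symm z)
      (mul (φ.symm z) (coordField φ u (φ.symm z)) (coordField φ v (φ.symm z))) : Cn n)) φ.target
  mul_comm : ∀ (x : M) (X Y : T n x), mul x X Y = mul x Y X
  mul_assoc : ∀ (x : M) (X Y Z : T n x), mul x (mul x X Y) Z = mul x X (mul x Y Z)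
  /-- `X ∘ Y = ∇_X Y` for flat local vector fields -/
  mul_eq_cov : ∀ (U : Set M) (X Y : ∀ x : M, T n x), IsOpen U →
    IsFlatFieldOn cov X U → IsFlatFieldOn cov Y U → ∀ x ∈ U, mul x (X x) (Y x) = cov Y x (X x)
  /-- a symmetric tensor of rank three with `A(X, Y, Z) = g(X ∘ Y, Z) = g(X, Y ∘ Z)` -/
  A : ∀ x : M, T n x →L[ℝ] T n x →L[ℝ] T n x →L[ℝ] ℝ
  A_symm_left : ∀ (x : M) (X Y Z : T n x), A x X Y Z = A x Y X Z
  A_symm_right : ∀ (x : M) (X Y Z : T n x), A x X Y Z = A x X Z Y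
  A_eq_left : ∀ (x : M) (X Y Z : T n x), A x X Y Z = g.inner x (mul x X Y) Z
  A_eq_right : ∀ (x : M) (X Y Z : T n x), A x X Y Z = g.inner x X (mul x Y Z)
  /-- everywhere locally a real potential `F` of the metric, which in affine coordinates has
  `A(∂_a, ∂_b, ∂_c̄) = ∂_a ∂_b ∂_c̄ F` and satisfies the Hermitian WDVV equation -/
  potential : ∀ p : M, ∃ (U : Set M) (F : M → ℝ), IsOpen U ∧ p ∈ U ∧ IsPotentialOn g F U ∧
    ∀ φ ∈ affine.charts, ∀ z ∈ φ.target, φ.symm z ∈ U →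
      (∀ a b c : Fin n,
        holPart (fun u => holPart (fun v => antiPart (fun w =>
          (A (φ.symm z) (coordField φ u (φ.symm z)) (coordField φ v (φ.symm z))
            (coordField φ w (φ.symm z)) : ℂ)) (e c)) (e b)) (e a)
        = dz a (dz b (dzbar c (inChart φ F))) z) ∧
      HermitianWDVVAt g F φ z

end Manifold

end Defs

end KahlerFrobenius

end

/-! ### Cauchy's formula on polydiscs and analyticity with values in Banach spaces. -/

section

open Set MeasureTheory Metric
open scoped Real Topology unitInterval

/-! The point is to find holomorphic coordinates in which `g` has constant components. Let `G` be
the matrix of `g` in a holomorphic chart. Vanishing curvature says that the Chern connection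
matrices `Γ_c = ∂_c G · G⁻¹` are holomorphic (`dzbar_chernMatrix`). Since `G` is Hermitian, along
each ray it solves `G' = Γ G + G Γᴴ`, where `Γ = ∑ z_c Γ_c`. Solving `P' = Γ P`, `P(0) = 1` with
analytic dependence on the endpoint `z` of the ray and using uniqueness for linear equations gives
`G = S G(0) Sᴴ` with `S` holomorphic (`exists_holomorphic_frame`). The Kähler condition makes the
forms `∑ S_{ai} dzᵃ` closed (`fderiv_frame_symm`), so the Poincaré lemma integrates them to
coordinates `w` in which `g` is constant (`exists_flat_coordinates`).

A transition map between two such charts is an isometry of constant metrics, so its second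
derivative vanishes (`fderiv_transition_eq_zero`) and it is affine on connected sets. Overlaps can
be disconnected; a Lebesgue number argument on the compact `M` shrinks the charts so that any two
that meet lie in one flat chart, and then a single affine map serves the whole overlap
(`exists_flat_affineStructure`).

The connection is differentiation in affine coordinates; its properties reduce to calculus in `ℂⁿ`
with a constant metric. As `∇_X Y = 0` for flat `Y`, the product and `A` are zero. In a flat chart
`∑ wⁱ g_{i j̄} w̄ʲ` is a potential (`IsFlatChart.isPotentialOn`). In affine coordinates `∂_b ∂_c̄ Φ
= g_{b c̄}` is constant, hence `Φ_{ab c̄} = 0` and both sides of WDVV vanish. -/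

theorem torusIntegral_prod_sub_inv_smul {n : ℕ} {F : Type*} [NormedAddCommGroup F]
    [NormedSpace ℂ F] [CompleteSpace F] {R : ℝ} (hR : 0 < R) {f : (Fin n → ℂ) → F}
    (hf : ∀ ζ ∈ closedBall (0 : Fin n → ℂ) R, DifferentiableAt ℂ f ζ)
    {z : Fin n → ℂ} (hz : z ∈ ball (0 : Fin n → ℂ) R) :
    (∯ ζ in T(0, fun _ => R), (∏ i, (ζ i - z i)⁻¹) • f ζ) = (2 * π * Complex.I : ℂ) ^ n • f z := by
  induction n with
  | zero =>
    simp only [torusIntegral_dim0, Finset.univ_eq_empty, Finset.prod_empty, one_smul, pow_zero]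
    congr 1
    exact Subsingleton.elim _ _
  | succ n ih =>
    have hz' : ∀ i, ‖z i‖ < R := by
      simpa [pi_norm_lt_iff hR] using hz
    have hmem : ∀ θ : Fin (n + 1) → ℝ, torusMap 0 (fun _ => R) θ ∈
        closedBall (0 : Fin (n + 1) → ℂ) R := by
      intro θ
      rw [mem_closedBall_zero_iff, pi_norm_le_iff_of_nonneg hR.le]
      intro i
      simp [torusMap, Complex.norm_exp_ofReal_mul_I, abs_of_pos hR]
    have hint : TorusIntegrable (fun ζ : Fin (n + 1) → ℂ => (∏ i, (ζ i - z i)⁻¹) • f ζ) 0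
        (fun _ => R) := by
      apply ContinuousOn.integrableOn_compact isCompact_Icc
      apply Continuous.continuousOn
      apply Continuous.smul
      · refine continuous_finsetProd _ fun i _ => Continuous.inv₀ ?_ ?_
        · unfold torusMap; fun_prop
        · intro θ h
          have h1 : ‖torusMap 0 (fun _ => R) θ i‖ = R := by
            simp [torusMap, Complex.norm_exp_ofReal_mul_I, abs_of_pos hR]
          rw [sub_eq_zero.1 h] at h1
          exact (hz' i).ne h1
      · rw [continuous_iff_continuousAt]
        intro θ
        refine ContinuousAt.comp (g := f) (hf _ (hmem θ)).continuousAt ?_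
        apply Continuous.continuousAt
        unfold torusMap; fun_prop
    -- Induction on the dimension: the inner torus integral is the inductive hypothesis with the
    -- first coordinate frozen, the remaining circle integral is the one-variable formula.
    rw [torusIntegral_succ hint]
    have hcons : ∀ x : ℂ, ‖x‖ ≤ R → ∀ y ∈ closedBall (0 : Fin n → ℂ) R,
        (Fin.cons x y : Fin (n + 1) → ℂ) ∈ closedBall (0 : Fin (n + 1) → ℂ) R := by
      intro x hx y hy
      rw [mem_closedBall_zero_iff, pi_norm_le_iff_of_nonneg hR.le] at hy ⊢
      intro i
      refine Fin.cases ?_ ?_ i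
      · simpa using hx
      · simpa using hy
    have hdc : ∀ (x : ℂ) (y : Fin n → ℂ), DifferentiableAt ℂ
        (fun p : ℂ × (Fin n → ℂ) => (Fin.cons p.1 p.2 : Fin (n + 1) → ℂ)) (x, y) := by
      intro x y
      rw [differentiableAt_pi]
      intro i
      refine Fin.cases ?_ ?_ i
      · simp
      · intro j
        simp only [Fin.cons_succ]
        fun_prop
    have htail : Fin.tail z ∈ ball (0 : Fin n → ℂ) R := by
      rw [mem_ball_zero_iff, pi_norm_lt_iff hR]
      exact fun i => hz' i.succ
    have hinner : ∀ x ∈ sphere (0 : ℂ) R,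
        (∯ y in T((0 : Fin (n + 1) → ℂ) ∘ Fin.succ, (fun _ => R) ∘ Fin.succ),
          (∏ i, ((Fin.cons x y : Fin (n + 1) → ℂ) i - z i)⁻¹) • f (Fin.cons x y))
        = (x - z 0)⁻¹ • ((2 * π * Complex.I : ℂ) ^ n • f (Fin.cons x (Fin.tail z))) := by
      intro x hx
      have hx' : ‖x‖ ≤ R := by simpa using hx.le
      have := ih (f := fun y => f (Fin.cons x y)) (z := Fin.tail z) (fun y hy =>
        (hf _ (hcons x hx' y hy)).comp (f := fun y : Fin n → ℂ => (Fin.cons x y : Fin (n+1) → ℂ)) y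
          ((hdc x y).comp y ((differentiableAt_const x).prodMk differentiableAt_id))) htail
      rw [← this, ← torusIntegral_smul]
      congr 1
      funext y
      rw [Fin.prod_univ_succ, mul_smul]
      simp [Fin.tail]
    have h2 : (∮ x in C((0 : Fin (n + 1) → ℂ) 0, R),
        ∯ y in T((0 : Fin (n + 1) → ℂ) ∘ Fin.succ, (fun _ => R) ∘ Fin.succ),
          (∏ i, ((Fin.cons x y : Fin (n + 1) → ℂ) i - z i)⁻¹) • f (Fin.cons x y)) =
        ∮ x in C((0 : ℂ), R), (x - z 0)⁻¹ •
          ((2 * π * Complex.I : ℂ) ^ n • f (Fin.cons x (Fin.tail z))) :=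
      circleIntegral.integral_congr hR.le hinner
    refine h2.trans ?_
    have hd : DiffContOnCl ℂ (fun x : ℂ => (2 * π * Complex.I : ℂ) ^ n •
        f (Fin.cons x (Fin.tail z))) (ball 0 R) := by
      apply DifferentiableOn.diffContOnCl
      rw [closure_ball _ hR.ne']
      intro x hx
      apply DifferentiableAt.differentiableWithinAt
      refine DifferentiableAt.const_smul ?_ _
      exact (hf _ (hcons x (by simpa using hx) _ (ball_subset_closedBall htail))).comp
        (f := fun x : ℂ => (Fin.cons x (Fin.tail z) : Fin (n+1) → ℂ)) x
          ((hdc x (Fin.tail z)).comp (f := fun x : ℂ => (x, Fin.tail z)) x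
            (differentiableAt_id.prodMk (differentiableAt_const (Fin.tail z))))
    rw [hd.circleIntegral_sub_inv_smul (by simpa using hz' 0)]
    rw [Fin.cons_self_tail, smul_smul, ← pow_succ']

/-- A function that is complex differentiable on a polydisc is analytic there, and so is the
function that maps `z` to the restriction of `f` to the segment from `0` to `z`. -/
theorem exists_analyticOnNhd_segment {n : ℕ} {F : Type*} [NormedAddCommGroup F]
    [NormedSpace ℂ F] [CompleteSpace F] {R : ℝ} (hR : 0 < R) {f : (Fin n → ℂ) → F}
    (hf : ∀ ζ ∈ closedBall (0 : Fin n → ℂ) R, DifferentiableAt ℂ f ζ) :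
    ∃ Φ : (Fin n → ℂ) → C(I, F), AnalyticOnNhd ℂ Φ (ball 0 R) ∧
      ∀ z ∈ ball (0 : Fin n → ℂ) R, ∀ t : I, Φ z t = f ((t : ℂ) • z) := by
  let K := ↥(Icc (0 : Fin n → ℝ) (fun _ => 2 * π))
  have : CompactSpace K := isCompact_iff_compactSpace.1 isCompact_Icc
  let μ : Measure K := Measure.comap Subtype.val volume
  have hμ : IsFiniteMeasure μ := by
    constructor
    rw [MeasurableEmbedding.comap_apply (MeasurableEmbedding.subtype_coe measurableSet_Icc)]
    rw [image_univ, Subtype.range_coe]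
    exact measure_Icc_lt_top
  let tm : K → (Fin n → ℂ) := fun θ => torusMap 0 (fun _ => R) θ
  have htm : Continuous tm := by
    have : Continuous (torusMap (0 : Fin n → ℂ) (fun _ => R)) := by unfold torusMap; fun_prop
    exact this.comp continuous_subtype_val
  have htmR : ∀ θ i, ‖tm θ i‖ = R := by
    intro θ i
    simp [tm, torusMap, Complex.norm_exp_ofReal_mul_I, abs_of_pos hR]
  have hmem : ∀ θ, tm θ ∈ closedBall (0 : Fin n → ℂ) R := by
    intro θ
    rw [mem_closedBall_zero_iff, pi_norm_le_iff_of_nonneg hR.le]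
    exact fun i => (htmR θ i).le
  let h : C(K, F) := ⟨fun θ => (((2 * π * Complex.I : ℂ) ^ n)⁻¹ *
      ∏ i, (R * Complex.exp (θ.1 i * Complex.I) * Complex.I : ℂ)) • f (tm θ), by
    refine Continuous.smul ?_ ?_
    · have : Continuous (fun θ : Fin n → ℝ => ((2 * π * Complex.I : ℂ) ^ n)⁻¹ *
          ∏ i, (R * Complex.exp (θ i * Complex.I) * Complex.I : ℂ)) := by fun_prop
      exact this.comp continuous_subtype_val
    · rw [continuous_iff_continuousAt]
      exact fun θ => ContinuousAt.comp (g := f) (hf _ (hmem θ)).continuousAt htm.continuousAt⟩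
  -- Integration of a kernel against the boundary values `h` of `f`. As a continuous linear map it
  -- preserves analyticity, so only the Cauchy kernel has to be shown analytic in `z`.
  let Λ : C(K, ℂ) →L[ℂ] F := LinearMap.mkContinuous
    { toFun := fun φ => ∫ θ, φ θ • h θ ∂μ
      map_add' := by
        intro φ ψ
        simp only [ContinuousMap.add_apply, add_smul]
        exact integral_add ((φ.continuous.smul h.continuous).integrable_of_hasCompactSupport
            (HasCompactSupport.of_compactSpace _))
          ((ψ.continuous.smul h.continuous).integrable_of_hasCompactSupport
            (HasCompactSupport.of_compactSpace _))
      map_smul' := by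
        intro c φ
        simp only [ContinuousMap.smul_apply, smul_assoc, integral_smul, RingHom.id_apply] }
    (‖h‖ * μ.real univ) (by
      intro φ
      refine (norm_integral_le_of_norm_le_const (C := ‖φ‖ * ‖h‖) ?_).trans_eq (by ring)
      refine Filter.Eventually.of_forall fun θ => ?_
      rw [norm_smul]
      exact mul_le_mul (φ.norm_coe_le_norm θ) (h.norm_coe_le_norm θ) (norm_nonneg _)
        (norm_nonneg _))
  let c : Fin n → C(I, C(K, ℂ)) := fun i =>
    ContinuousMap.const I ⟨fun θ => tm θ i, (continuous_apply i).comp htm⟩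
  let τ : C(I, C(K, ℂ)) := ⟨fun t => ((t : ℝ) : ℂ) • (1 : C(K, ℂ)), by fun_prop⟩
  -- The denominator `ζ_i - t z_i`, as an element of the Banach algebra `C(I, C(K, ℂ))`. It is
  -- affine in `z` and invertible for `‖z‖ < R`; inversion in a Banach algebra is analytic, which
  -- yields analyticity uniformly in `t`.
  let k : Fin n → (Fin n → ℂ) → C(I, C(K, ℂ)) := fun i z => c i - z i • τ
  have hka : ∀ i z t θ, k i z t θ = tm θ i - t * z i := by
    intro i z t θ
    simp [k, c, τ, mul_comm]
  have hne : ∀ i, ∀ z ∈ ball (0 : Fin n → ℂ) R, ∀ t θ, tm θ i - (t : I) * z i ≠ 0 := by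
    intro i z hz t θ h0
    have h1 := htmR θ i
    rw [sub_eq_zero.1 h0, norm_mul, Complex.norm_real, Real.norm_of_nonneg t.2.1] at h1
    have hz' : ‖z i‖ < R := (norm_le_pi_norm z i).trans_lt (by simpa using hz)
    nlinarith [t.2.2, norm_nonneg (z i), t.2.1]
  have hunit : ∀ i, ∀ z ∈ ball (0 : Fin n → ℂ) R, IsUnit (k i z) := by
    intro i z hz
    rw [ContinuousMap.isUnit_iff_forall_isUnit]
    intro t
    rw [ContinuousMap.isUnit_iff_forall_ne_zero]
    intro θ
    rw [hka]
    exact hne i z hz t θ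
  have hinv : ∀ i, ∀ z ∈ ball (0 : Fin n → ℂ) R, ∀ t θ,
      Ring.inverse (k i z) t θ = (tm θ i - t * z i)⁻¹ := by
    intro i z hz t θ
    have h1 := congrArg (fun g : C(I, C(K, ℂ)) => g t θ) (Ring.inverse_mul_cancel _ (hunit i z hz))
    simp only [ContinuousMap.mul_apply, hka, ContinuousMap.one_apply] at h1
    exact eq_inv_of_mul_eq_one_left h1
  have hkan : ∀ i, ∀ z ∈ ball (0 : Fin n → ℂ) R,
      AnalyticAt ℂ (fun z => Ring.inverse (k i z)) z := by
    intro i z hz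
    obtain ⟨u, hu⟩ := hunit i z hz
    refine AnalyticAt.comp (g := Ring.inverse) (f := k i) (hu ▸ analyticAt_inverse u) ?_
    refine analyticAt_const.sub (AnalyticAt.fun_smul ?_ analyticAt_const)
    exact (ContinuousLinearMap.proj (R := ℂ) (φ := fun _ : Fin n => ℂ) i).analyticAt z
  refine ⟨fun z => Λ.compLeftContinuous ℂ I (∏ i, Ring.inverse (k i z)), ?_, ?_⟩
  · intro z hz
    refine ((Λ.compLeftContinuous ℂ I).analyticAt _).comp (f := fun z => ∏ i, Ring.inverse (k i z)) ?_
    exact Finset.analyticAt_fun_prod _ fun i _ => hkan i z hz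
  · intro z hz t
    have htz : (t : ℂ) • z ∈ ball (0 : Fin n → ℂ) R := by
      rw [mem_ball_zero_iff] at hz ⊢
      rw [norm_smul, Complex.norm_real, Real.norm_of_nonneg t.2.1]
      nlinarith [t.2.2, norm_nonneg z, t.2.1]
    have h1 : Λ ((∏ i, Ring.inverse (k i z)) t) = ((2 * π * Complex.I : ℂ) ^ n)⁻¹ •
        ∯ ζ in T(0, fun _ => R), (∏ i, (ζ i - ((t : ℂ) • z) i)⁻¹) • f ζ := by
      have : ∀ θ : K, ((∏ i, Ring.inverse (k i z)) t θ) • h θ =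
          ((2 * π * Complex.I : ℂ) ^ n)⁻¹ •
            (fun θ : Fin n → ℝ => (∏ i, (R * Complex.exp (θ i * Complex.I) * Complex.I : ℂ)) •
              ((∏ i, (torusMap 0 (fun _ => R) θ i - ((t : ℂ) • z) i)⁻¹) •
                f (torusMap 0 (fun _ => R) θ))) θ.1 := by
        intro θ
        have : (∏ i, Ring.inverse (k i z)) t θ = ∏ i, (tm θ i - t * z i)⁻¹ := by
          rw [ContinuousMap.prod_apply, ContinuousMap.prod_apply]
          exact Finset.prod_congr rfl fun i _ => hinv i z hz t θ
        rw [this]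
        simp only [h, ContinuousMap.coe_mk, smul_smul, tm, Pi.smul_apply, smul_eq_mul]
        congr 1
        ring
      simp only [Λ, LinearMap.mkContinuous_apply, LinearMap.coe_mk, AddHom.coe_mk, this]
      rw [integral_smul]
      congr 1
      exact integral_subtype_comap measurableSet_Icc
        (fun θ : Fin n → ℝ => (∏ i, (R * Complex.exp (θ i * Complex.I) * Complex.I : ℂ)) •
          ((∏ i, (torusMap 0 (fun _ => R) θ i - ((t : ℂ) • z) i)⁻¹) •
            f (torusMap 0 (fun _ => R) θ)))
    have h2 := torusIntegral_prod_sub_inv_smul hR hf htz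
    rw [h2, smul_smul, inv_mul_cancel₀, one_smul] at h1
    · exact h1
    · exact pow_ne_zero _ (by simp [Real.pi_ne_zero])

/-- Evaluation at the endpoint `t = 1` is linear and continuous, so analyticity of the segment map
passes to `f`. This raises complex differentiable flat coordinates to class `ω`. -/
theorem DifferentiableOn.analyticAt_of_isOpen_pi {n : ℕ} {F : Type*} [NormedAddCommGroup F]
    [NormedSpace ℂ F] [CompleteSpace F] {f : (Fin n → ℂ) → F} {U : Set (Fin n → ℂ)}
    (hf : DifferentiableOn ℂ f U) (hU : IsOpen U) {p : Fin n → ℂ} (hp : p ∈ U) :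
    AnalyticAt ℂ f p := by
  obtain ⟨R, hR, hRU⟩ := nhds_basis_closedBall.mem_iff.1 (hU.mem_nhds hp)
  have hf' : ∀ ζ ∈ closedBall (0 : Fin n → ℂ) R, DifferentiableAt ℂ (fun z => f (z + p)) ζ := by
    intro ζ hζ
    have h1 : DifferentiableAt ℂ f (ζ + p) :=
      hf.differentiableAt (hU.mem_nhds (hRU (by simpa using hζ)))
    exact h1.comp (f := fun z => z + p) ζ (by fun_prop)
  obtain ⟨Φ, hΦ, hΦf⟩ := exists_analyticOnNhd_segment hR hf'
  have h1 : AnalyticAt ℂ (fun z => Φ z 1) 0 :=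
    ((ContinuousMap.evalCLM (M := F) ℂ (1 : I)).analyticAt _).comp
      (f := Φ) (hΦ 0 (mem_ball_self hR))
  have h2 : AnalyticAt ℂ (fun z => f (z + p)) 0 := by
    refine h1.congr ?_
    filter_upwards [ball_mem_nhds _ hR] with z hz
    simp [hΦf z hz]
  have h3 : AnalyticAt ℂ (fun z => f ((z - p) + p)) p := by
    refine AnalyticAt.comp (g := fun z => f (z + p)) (f := fun z => z - p) (by simpa using h2) ?_
    fun_prop
  simpa using h3

end

/-! ### Linear differential equations with analytic parameters. -/

section

open Set MeasureTheory Metric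
open scoped Real Topology unitInterval

/-- The linear equation `P = 1 + L (a P)` in a Banach algebra has a solution that depends
analytically on parameters on which `a` depends analytically, as long as `a` is small. -/
theorem exists_analyticAt_fixedPoint {B : Type*} [NormedRing B] [NormedAlgebra ℂ B]
    [CompleteSpace B] (L : B →L[ℂ] B) {E : Type*} [NormedAddCommGroup E] [NormedSpace ℂ E]
    {a : E → B} {x : E} (ha : AnalyticAt ℂ a x) (h0 : a x = 0) :
    ∃ P : E → B, AnalyticAt ℂ P x ∧ ∀ᶠ z in 𝓝 x, P z = 1 + L (a z * P z) := by
  -- The equation reads `(1 - Λ (a z)) P = 1`. At `x` the operator is the identity because `a x =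
  -- 0`, and units form an open set on which inversion is analytic.
  let Λ : B →L[ℂ] (B →L[ℂ] B) :=
    (ContinuousLinearMap.compL ℂ B B B L) ∘L (ContinuousLinearMap.mul ℂ B)
  have hΛ : ∀ p q, Λ p q = L (p * q) := fun p q => rfl
  have h1 : AnalyticAt ℂ (fun z => 1 - Λ (a z)) x :=
    analyticAt_const.sub ((Λ.analyticAt _).comp (f := a) ha)
  have hu : (1 : B →L[ℂ] B) - Λ (a x) = ((1 : (B →L[ℂ] B)ˣ) : B →L[ℂ] B) := by
    simp [h0]
  have h2 : AnalyticAt ℂ (fun z => Ring.inverse (1 - Λ (a z))) x := by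
    refine AnalyticAt.comp (g := Ring.inverse) (f := fun z => 1 - Λ (a z)) ?_ h1
    rw [hu]
    exact analyticAt_inverse 1
  refine ⟨fun z => Ring.inverse (1 - Λ (a z)) 1, ?_, ?_⟩
  · exact ((ContinuousLinearMap.apply ℂ B (1 : B)).analyticAt _).comp
      (f := fun z => Ring.inverse (1 - Λ (a z))) h2
  · have h3 : ∀ᶠ z in 𝓝 x, IsUnit (1 - Λ (a z)) := by
      refine h1.continuousAt.eventually_mem (Units.isOpen.mem_nhds ?_)
      rw [hu]
      exact Units.isUnit 1
    filter_upwards [h3] with z hz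
    have h4 := congrArg (fun L : B →L[ℂ] B => L 1) (Ring.mul_inverse_cancel _ hz)
    have h5 : Ring.inverse (1 - Λ (a z)) 1 - Λ (a z) (Ring.inverse (1 - Λ (a z)) 1) = 1 := h4
    rw [← sub_eq_iff_eq_add, ← hΛ]
    exact h5

section Volterra

variable {𝔸 : Type*} [NormedRing 𝔸] [NormedAlgebra ℂ 𝔸] [CompleteSpace 𝔸]

/-- The operator `p ↦ (t ↦ ∫₀ᵗ p)` on continuous functions on the unit interval. -/
noncomputable def volterraCLM (𝔸 : Type*) [NormedRing 𝔸] [NormedAlgebra ℂ 𝔸] [CompleteSpace 𝔸] :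
    C(I, 𝔸) →L[ℂ] C(I, 𝔸) :=
  LinearMap.mkContinuous
    { toFun := fun p => ⟨fun t => ∫ s in (0 : ℝ)..t, p (projIcc 0 1 zero_le_one s), by
        have : Continuous fun t : ℝ => ∫ s in (0 : ℝ)..t, p (projIcc 0 1 zero_le_one s) :=
          intervalIntegral.continuous_primitive (fun a b =>
            (p.continuous.comp continuous_projIcc).intervalIntegrable a b) 0
        exact this.comp continuous_subtype_val⟩
      map_add' := by
        intro p q
        ext t
        exact intervalIntegral.integral_add
          ((p.continuous.comp continuous_projIcc).intervalIntegrable _ _)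
          ((q.continuous.comp continuous_projIcc).intervalIntegrable _ _)
      map_smul' := by
        intro c p
        ext t
        exact intervalIntegral.integral_smul c _ }
    1 (by
      intro p
      rw [one_mul, ContinuousMap.norm_le _ (norm_nonneg _)]
      intro t
      refine (intervalIntegral.norm_integral_le_of_norm_le_const (C := ‖p‖)
        fun s _ => p.norm_coe_le_norm _).trans ?_
      rw [sub_zero, abs_of_nonneg t.2.1]
      exact mul_le_of_le_one_right (norm_nonneg _) t.2.2)

theorem volterraCLM_apply (p : C(I, 𝔸)) (t : I) :
    volterraCLM 𝔸 p t = ∫ s in (0 : ℝ)..t, p (projIcc 0 1 zero_le_one s) := rfl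

/-- The linear differential equation `P' = a P`, `P(0) = 1` on the unit interval has a solution
that depends analytically on parameters on which the coefficient `a` depends analytically. -/
theorem exists_analyticAt_linear_ode {E : Type*} [NormedAddCommGroup E] [NormedSpace ℂ E]
    {a : E → C(I, 𝔸)} {x : E} (ha : AnalyticAt ℂ a x) (h0 : a x = 0) :
    ∃ P : E → C(I, 𝔸), AnalyticAt ℂ P x ∧ ∀ᶠ z in 𝓝 x, ∀ t : I,
      P z t = 1 + ∫ s in (0 : ℝ)..t, (a z * P z) (projIcc 0 1 zero_le_one s) := by
  obtain ⟨P, hP, hPz⟩ := exists_analyticAt_fixedPoint (volterraCLM 𝔸) ha h0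
  refine ⟨P, hP, hPz.mono fun z hz t => ?_⟩
  rw [← volterraCLM_apply]
  exact congrArg (fun p : C(I, 𝔸) => p t) hz

/-- If `P` and `Q` solve `P' = a P`, `Q' = Q b` and are `1` at `0`, then the solutions of
`X' = a X + X b` are `P X(0) Q`. -/
theorem eq_mul_mul_of_linear_ode {a b P Q : C(I, 𝔸)}
    (hP : ∀ t : I, P t = 1 + ∫ s in (0 : ℝ)..t, (a * P) (projIcc 0 1 zero_le_one s))
    (hQ : ∀ t : I, Q t = 1 + ∫ s in (0 : ℝ)..t, (Q * b) (projIcc 0 1 zero_le_one s))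
    {X : ℝ → 𝔸} (hX : ∀ t : I, HasDerivAt X (a t * X t + X t * b t) t) :
    X 1 = P 1 * X 0 * Q 1 := by
  -- `projIcc` extends the integrand by constants, so the primitive is differentiable on the whole
  -- line, also at the endpoints `0` and `1`.
  have key : ∀ (c R : C(I, 𝔸)),
      (∀ t : I, R t = 1 + ∫ s in (0 : ℝ)..t, c (projIcc 0 1 zero_le_one s)) →
      ∃ r : ℝ → 𝔸, (∀ t : I, r t = R t) ∧ ∀ t : I, HasDerivAt r (c t) t := by
    intro c R h
    refine ⟨fun t => 1 + ∫ s in (0 : ℝ)..t, c (projIcc 0 1 zero_le_one s), fun t => (h t).symm,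
      fun t => ?_⟩
    have hc : Continuous fun s : ℝ => c (projIcc 0 1 zero_le_one s) :=
      c.continuous.comp continuous_projIcc
    have := (hc.integral_hasStrictDerivAt 0 t).hasDerivAt.const_add 1
    simpa using this
  obtain ⟨p, hp, hp'⟩ := key _ _ hP
  obtain ⟨q, hq, hq'⟩ := key _ _ hQ
  have hp0 : p 0 = 1 := by
    have := hp 0
    rw [hP] at this
    simpa using this
  have hq0 : q 0 = 1 := by
    have := hq 0
    rw [hQ] at this
    simpa using this
  -- Both `X` and `P X(0) Q` follow this time-dependent field, which is Lipschitz uniformly in time,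
  -- and they agree at `0`.
  let v : ℝ → 𝔸 → 𝔸 := fun t x => a (projIcc 0 1 zero_le_one t) * x
    + x * b (projIcc 0 1 zero_le_one t)
  have hv : ∀ t, LipschitzWith (‖a‖₊ + ‖b‖₊) (v t) := by
    intro t
    refine LipschitzWith.of_dist_le_mul fun x y => ?_
    rw [dist_eq_norm, dist_eq_norm]
    have : v t x - v t y = a (projIcc 0 1 zero_le_one t) * (x - y)
        + (x - y) * b (projIcc 0 1 zero_le_one t) := by
      simp only [v, mul_sub, sub_mul]; abel
    rw [this]
    refine (norm_add_le _ _).trans ?_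
    have h1 := (norm_mul_le (a (projIcc 0 1 zero_le_one t)) (x - y)).trans
      (mul_le_mul_of_nonneg_right (a.norm_coe_le_norm _) (norm_nonneg _))
    have h2 := (norm_mul_le (x - y) (b (projIcc 0 1 zero_le_one t))).trans
      (mul_le_mul_of_nonneg_left (b.norm_coe_le_norm _) (norm_nonneg _))
    push_cast
    linarith
  have hX' : ∀ t ∈ Icc (0 : ℝ) 1, HasDerivAt X (v t (X t)) t := by
    intro t ht
    simpa [v, projIcc_of_mem zero_le_one ht] using hX ⟨t, ht⟩
  have hY' : ∀ t ∈ Icc (0 : ℝ) 1, HasDerivAt (fun t => p t * X 0 * q t)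
      (v t (p t * X 0 * q t)) t := by
    intro t ht
    have h1 := ((hp' ⟨t, ht⟩).mul_const (X 0)).mul (hq' ⟨t, ht⟩)
    refine h1.congr_deriv ?_
    simp only [v, projIcc_of_mem zero_le_one ht, ContinuousMap.mul_apply, ← hp, ← hq]
    noncomm_ring
  have := ODE_solution_unique_of_mem_Icc_right (v := v) (s := fun _ => univ) (K := ‖a‖₊ + ‖b‖₊)
    (f := X) (g := fun t => p t * X 0 * q t) (a := 0) (b := 1)
    (fun t _ => (hv t).lipschitzOnWith)
    (fun t ht => (hX' t ht).continuousAt.continuousWithinAt)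
    (fun t ht => (hX' t (Ico_subset_Icc_self ht)).hasDerivWithinAt) (fun _ _ => mem_univ _)
    (fun t ht => (hY' t ht).continuousAt.continuousWithinAt)
    (fun t ht => (hY' t (Ico_subset_Icc_self ht)).hasDerivWithinAt) (fun _ _ => mem_univ _)
    (by simp [hp0, hq0]) (right_mem_Icc.2 zero_le_one)
  have h1 := hp 1
  have h2 := hq 1
  rw [this]
  simp only [← h1, ← h2]
  rfl

end Volterra

end

/-! ### Calculus of Wirtinger derivatives. -/

section

open Set MeasureTheory Metric Filter
open scoped Real Topology unitInterval Manifold ContDiff Bundle ComplexConjugate Matrix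

namespace KahlerFrobenius
variable {n : ℕ}

section Wirtinger

theorem dz_congr {f g : Cn n → ℂ} {z : Cn n} (h : f =ᶠ[𝓝 z] g) (a : Fin n) :
    dz a f z = dz a g z := by
  unfold dz; rw [h.fderiv_eq]

theorem dzbar_congr {f g : Cn n → ℂ} {z : Cn n} (h : f =ᶠ[𝓝 z] g) (a : Fin n) :
    dzbar a f z = dzbar a g z := by
  unfold dzbar; rw [h.fderiv_eq]

theorem dz_const (c : ℂ) (a : Fin n) (z : Cn n) : dz a (fun _ => c) z = 0 := by
  simp [dz, holPart]

theorem dz_mul {f g : Cn n → ℂ} {z : Cn n} (hf : DifferentiableAt ℝ f z)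
    (hg : DifferentiableAt ℝ g z) (a : Fin n) :
    dz a (fun y => f y * g y) z = dz a f z * g z + f z * dz a g z := by
  unfold dz holPart
  rw [fderiv_fun_mul hf hg]
  simp
  ring

theorem dzbar_mul {f g : Cn n → ℂ} {z : Cn n} (hf : DifferentiableAt ℝ f z)
    (hg : DifferentiableAt ℝ g z) (a : Fin n) :
    dzbar a (fun y => f y * g y) z = dzbar a f z * g z + f z * dzbar a g z := by
  unfold dzbar antiPart
  rw [fderiv_fun_mul hf hg]
  simp
  ring

theorem dz_sum {ι : Type*} (s : Finset ι) {f : ι → Cn n → ℂ} {z : Cn n}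
    (hf : ∀ i ∈ s, DifferentiableAt ℝ (f i) z) (a : Fin n) :
    dz a (fun y => ∑ i ∈ s, f i y) z = ∑ i ∈ s, dz a (f i) z := by
  unfold dz holPart
  rw [fderiv_fun_sum hf]
  simp [Finset.mul_sum, ← Finset.sum_sub_distrib, Finset.sum_div]

theorem dzbar_sum {ι : Type*} (s : Finset ι) {f : ι → Cn n → ℂ} {z : Cn n}
    (hf : ∀ i ∈ s, DifferentiableAt ℝ (f i) z) (a : Fin n) :
    dzbar a (fun y => ∑ i ∈ s, f i y) z = ∑ i ∈ s, dzbar a (f i) z := by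
  unfold dzbar antiPart
  rw [fderiv_fun_sum hf]
  simp [Finset.mul_sum, ← Finset.sum_add_distrib, Finset.sum_div]

theorem fderiv_conj_apply {f : Cn n → ℂ} {z : Cn n} (hf : DifferentiableAt ℝ f z) (v : Cn n) :
    fderiv ℝ (fun y => conj (f y)) z v = conj (fderiv ℝ f z v) := by
  have h := (Complex.conjCLE.toContinuousLinearMap.hasFDerivAt (x := f z)).comp z hf.hasFDerivAt
  exact congrArg (fun L => L v) h.fderiv

theorem dz_conj {f : Cn n → ℂ} {z : Cn n} (hf : DifferentiableAt ℝ f z) (a : Fin n) :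
    dz a (fun y => conj (f y)) z = conj (dzbar a f z) := by
  simp only [dz, dzbar, holPart, antiPart, fderiv_conj_apply hf]
  simp [map_ofNat]
  ring

theorem dzbar_conj {f : Cn n → ℂ} {z : Cn n} (hf : DifferentiableAt ℝ f z) (a : Fin n) :
    dzbar a (fun y => conj (f y)) z = conj (dz a f z) := by
  simp only [dz, dzbar, holPart, antiPart, fderiv_conj_apply hf]
  simp [map_ofNat]

theorem dz_of_differentiableAt {f : Cn n → ℂ} {z : Cn n} (hf : DifferentiableAt ℂ f z)
    (a : Fin n) : dz a f z = fderiv ℂ f z (e a) := by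
  simp only [dz, holPart, hf.fderiv_restrictScalars ℝ, ContinuousLinearMap.coe_restrictScalars',
    map_smul, smul_eq_mul]
  ring_nf
  simp
  ring

theorem dzbar_of_differentiableAt {f : Cn n → ℂ} {z : Cn n} (hf : DifferentiableAt ℂ f z)
    (a : Fin n) : dzbar a f z = 0 := by
  simp only [dzbar, antiPart, hf.fderiv_restrictScalars ℝ, ContinuousLinearMap.coe_restrictScalars',
    map_smul, smul_eq_mul]
  ring_nf
  simp

theorem sum_re_im_smul_e (v : Cn n) :
    v = ∑ a, ((v a).re • e a + (v a).im • (Complex.I • e a) : Cn n) := by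
  ext i
  simp only [e, Finset.sum_apply, Pi.add_apply, Pi.smul_apply, Pi.single_apply]
  rw [Finset.sum_eq_single i]
  · simp
  · intro b _ hb
    simp [hb.symm]
  · simp

/-- The splitting of `L` into its complex linear and antilinear parts, in the standard basis. -/
theorem realLinear_eq_sum (L : Cn n →L[ℝ] ℂ) (v : Cn n) :
    L v = ∑ a, (v a * holPart L (e a) + conj (v a) * antiPart L (e a)) := by
  conv_lhs => rw [sum_re_im_smul_e v, map_sum]
  refine Finset.sum_congr rfl fun a _ => ?_
  rw [map_add, map_smul, map_smul]
  simp only [holPart, antiPart]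
  generalize L (e a) = x
  generalize L (Complex.I • e a) = y
  apply Complex.ext <;> simp <;> ring

theorem fderiv_eq_sum_dz (f : Cn n → ℂ) (z v : Cn n) :
    fderiv ℝ f z v = ∑ a, (v a * dz a f z + conj (v a) * dzbar a f z) :=
  realLinear_eq_sum _ v

/-- Cauchy–Riemann: without its antilinear part the real differential is complex linear. -/
theorem differentiableAt_of_dzbar_eq_zero {f : Cn n → ℂ} {z : Cn n} (hf : DifferentiableAt ℝ f z)
    (h : ∀ a, dzbar a f z = 0) : DifferentiableAt ℂ f z := by
  rw [differentiableAt_iff_restrictScalars ℝ hf]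
  let L : Cn n →ₗ[ℂ] ℂ :=
    { toFun := fun v => fderiv ℝ f z v
      map_add' := fun u v => map_add _ u v
      map_smul' := fun c v => by
        simp only [fderiv_eq_sum_dz, h, RingHom.id_apply, smul_eq_mul, Finset.mul_sum,
          Pi.smul_apply, mul_zero, add_zero, mul_assoc] }
  exact ⟨L.toContinuousLinearMap, by ext v; rfl⟩

theorem contDiffAt_dz {f : Cn n → ℂ} {z : Cn n} (hf : ContDiffAt ℝ ∞ f z) (a : Fin n) :
    ContDiffAt ℝ ∞ (dz a f) z := by
  have h : ContDiffAt ℝ ∞ (fderiv ℝ f) z := hf.fderiv_right (m := ∞) le_rfl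
  unfold dz holPart
  exact ((h.clm_apply contDiffAt_const).sub
    (contDiffAt_const.mul (h.clm_apply contDiffAt_const))).div_const _

theorem fderiv_dz_apply {f : Cn n → ℂ} {z : Cn n} (hf : ContDiffAt ℝ ∞ f z) (a : Fin n)
    (v : Cn n) : fderiv ℝ (dz a f) z v =
      holPart (fun u => fderiv ℝ (fderiv ℝ f) z v u) (e a) := by
  have h : DifferentiableAt ℝ (fderiv ℝ f) z :=
    (hf.fderiv_right (m := ∞) le_rfl).differentiableAt (by simp)
  have h1 : ∀ u, HasFDerivAt (fun y => fderiv ℝ f y u) ((fderiv ℝ (fderiv ℝ f) z).flip u) z :=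
    fun u => by
      have := h.hasFDerivAt.clm_apply (hasFDerivAt_const u z)
      simpa using this
  have h2 : HasFDerivAt (dz a f) _ z :=
    ((h1 (e a)).sub ((h1 (Complex.I • e a)).const_mul Complex.I)).mul_const (2⁻¹ : ℂ)
  rw [h2.fderiv]
  simp [holPart]
  ring

theorem fderiv_dzbar_apply {f : Cn n → ℂ} {z : Cn n} (hf : ContDiffAt ℝ ∞ f z) (a : Fin n)
    (v : Cn n) : fderiv ℝ (dzbar a f) z v =
      antiPart (fun u => fderiv ℝ (fderiv ℝ f) z v u) (e a) := by
  have h : DifferentiableAt ℝ (fderiv ℝ f) z :=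
    (hf.fderiv_right (m := ∞) le_rfl).differentiableAt (by simp)
  have h1 : ∀ u, HasFDerivAt (fun y => fderiv ℝ f y u) ((fderiv ℝ (fderiv ℝ f) z).flip u) z :=
    fun u => by
      have := h.hasFDerivAt.clm_apply (hasFDerivAt_const u z)
      simpa using this
  have h2 : HasFDerivAt (dzbar a f) _ z :=
    ((h1 (e a)).add ((h1 (Complex.I • e a)).const_mul Complex.I)).mul_const (2⁻¹ : ℂ)
  rw [h2.fderiv]
  simp [antiPart]
  ring

/-- Both sides expand into the same four real second derivatives, up to the order of
differentiation. -/
theorem dzbar_dz_comm {f : Cn n → ℂ} {z : Cn n} (hf : ContDiffAt ℝ ∞ f z) (a b : Fin n) :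
    dzbar b (dz a f) z = dz a (dzbar b f) z := by
  have hs : ∀ u v, fderiv ℝ (fderiv ℝ f) z u v = fderiv ℝ (fderiv ℝ f) z v u := by
    intro u v
    refine (hf.isSymmSndFDerivAt ?_).eq u v
    rw [minSmoothness_of_isRCLikeNormedField]
    exact WithTop.coe_le_coe.2 (le_top : (2 : ℕ∞) ≤ ⊤)
  simp only [dzbar, antiPart, fderiv_dz_apply hf]
  simp only [dz, holPart]
  change _ = (fderiv ℝ (dzbar b f) z _ - _ * fderiv ℝ (dzbar b f) z _) / 2
  simp only [fderiv_dzbar_apply hf, antiPart]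
  rw [hs (e b) (e a), hs (e b) (Complex.I • e a), hs (Complex.I • e b) (e a),
    hs (Complex.I • e b) (Complex.I • e a)]
  ring

end Wirtinger
end KahlerFrobenius

end

/-! ### Holomorphic frames in which a flat Kähler metric is constant. -/

noncomputable section

open Set MeasureTheory Metric Filter
open scoped Real Topology unitInterval Manifold ContDiff Bundle ComplexConjugate Matrix

namespace KahlerFrobenius
variable {n : ℕ}

/-- The components of a flat Kähler metric on an open set of `ℂⁿ`. -/
structure IsFlatKahlerMatrix (G : Cn n → Matrix (Fin n) (Fin n) ℂ) (U : Set (Cn n)) : Prop where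
  isOpen : IsOpen U
  contDiffAt : ∀ z ∈ U, ∀ a b, ContDiffAt ℝ ∞ (fun y => G y a b) z
  hermitian : ∀ z ∈ U, (G z)ᴴ = G z
  isUnit : ∀ z ∈ U, IsUnit (G z)
  curvature : ∀ z ∈ U, ∀ a b c d, dz c (dzbar d fun y => G y a b) z
    = ∑ k, ∑ f, (G z)⁻¹ f k * dz c (fun y => G y a f) z * dzbar d (fun y => G y k b) z
  closed : ∀ z ∈ U, ∀ a b c, dz c (fun y => G y a b) z = dz a (fun y => G y c b) z

/-- If `G` satisfies a linear differential equation `G' = Γ G + G τ(Γ)` along all rays with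
holomorphic coefficients `Γ`, then `G = S G(0) τ(S)` for a holomorphic `S`. -/
theorem exists_analyticAt_factorization {𝔸 : Type*} [NormedRing 𝔸] [NormedAlgebra ℂ 𝔸]
    [CompleteSpace 𝔸] {G : Cn n → 𝔸} {τ : 𝔸 →L[ℝ] 𝔸} {Γ : Fin n → Cn n → 𝔸} {R : ℝ} (hR : 0 < R)
    (hτ : ∀ A B, τ (A * B) = τ B * τ A) (hτ_one : τ 1 = 1)
    (hΓ : ∀ c, ∀ ζ ∈ closedBall (0 : Cn n) R, DifferentiableAt ℂ (Γ c) ζ)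
    (hG : ∀ (z : Cn n) (t : ℝ), t • z ∈ closedBall (0 : Cn n) R →
      HasDerivAt (fun s : ℝ => G (s • z)) ((∑ c, z c • Γ c (t • z)) * G (t • z)
        + G (t • z) * τ (∑ c, z c • Γ c (t • z))) t) :
    ∃ S : Cn n → 𝔸, AnalyticAt ℂ S 0 ∧ ∀ᶠ z in 𝓝 (0 : Cn n), G z = S z * G 0 * τ (S z) := by
  choose Φ hΦ hΦG using fun c => exists_analyticOnNhd_segment hR (hΓ c)
  -- The coefficient of the equation along the ray to `z`, as a curve in `t`. The factors `z c` make
  -- it vanish at `z = 0`, which is the smallness that `exists_analyticAt_linear_ode` asks for.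
  let a : Cn n → C(I, 𝔸) := fun z => ∑ c, z c • Φ c z
  have ha : AnalyticAt ℂ a 0 := by
    refine Finset.analyticAt_fun_sum _ fun c _ => AnalyticAt.fun_smul ?_ (hΦ c 0 (mem_ball_self hR))
    exact (ContinuousLinearMap.proj (R := ℂ) (φ := fun _ : Fin n => ℂ) c).analyticAt 0
  obtain ⟨P, hP, hPz⟩ := exists_analyticAt_linear_ode ha (by simp [a])
  refine ⟨fun z => P z 1, ?_, ?_⟩
  · exact ((ContinuousMap.evalCLM (M := 𝔸) ℂ (1 : I)).analyticAt _).comp (f := P) hP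
  · filter_upwards [hPz, ball_mem_nhds _ hR] with z hz hzR
    let b : C(I, 𝔸) := ⟨fun t => τ (a z t), τ.continuous.comp (a z).continuous⟩
    -- The anti-automorphism `τ` turns `P' = a P` into `Q' = Q b`; only real linearity of `τ` is
    -- available, so `Q` is not analytic in `z`, and need not be.
    let Q : C(I, 𝔸) := ⟨fun t => τ (P z t), τ.continuous.comp (P z).continuous⟩
    have hQ : ∀ t : I, Q t = 1 + ∫ s in (0 : ℝ)..t, (Q * b) (projIcc 0 1 zero_le_one s) := by
      intro t
      have h1 : Q t = τ (P z t) := rfl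
      rw [h1, hz t, map_add, hτ_one, ← ContinuousLinearMap.intervalIntegral_comp_comm]
      · congr 1
        refine intervalIntegral.integral_congr fun s _ => ?_
        simp only [ContinuousMap.mul_apply, hτ]
        rfl
      · exact ((a z * P z).continuous.comp continuous_projIcc).intervalIntegrable _ _
    have hray : ∀ t : I, HasDerivAt (fun s : ℝ => G (s • z))
        (a z t * G ((t : ℝ) • z) + G ((t : ℝ) • z) * b t) t := by
      intro t
      have htz : (t : ℝ) • z ∈ closedBall (0 : Cn n) R := by
        rw [mem_ball_zero_iff] at hzR
        rw [mem_closedBall_zero_iff, norm_smul, Real.norm_of_nonneg t.2.1]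
        nlinarith [t.2.2, norm_nonneg z, t.2.1]
      have h1 : a z t = ∑ c, z c • Γ c ((t : ℝ) • z) := by
        simp only [a, ContinuousMap.sum_apply, ContinuousMap.smul_apply, hΦG _ z hzR]
        rfl
      have h2 : b t = τ (a z t) := rfl
      rw [h2, h1]
      exact hG z t htz
    have h3 := eq_mul_mul_of_linear_ode hz hQ hray
    simp only [one_smul, zero_smul] at h3
    exact h3

section MatrixCalculus

attribute [local instance] Matrix.linftyOpNormedRing Matrix.linftyOpNormedAlgebra

/-- The entry of a matrix as a continuous linear map. -/
def entryCLM (a b : Fin n) : Matrix (Fin n) (Fin n) ℂ →L[ℂ] ℂ :=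
  (Matrix.entryLinearMap ℂ ℂ a b).toContinuousLinearMap

/-- The conjugate transpose of a matrix as a continuous linear map. -/
def conjTransposeCLM (n : ℕ) : Matrix (Fin n) (Fin n) ℂ →L[ℝ] Matrix (Fin n) (Fin n) ℂ :=
  (Matrix.conjTransposeLinearEquiv (Fin n) (Fin n) ℝ ℂ).toLinearMap.toContinuousLinearMap

theorem eq_sum_smul_single (M : Matrix (Fin n) (Fin n) ℂ) :
    M = ∑ a, ∑ b, (M a b) • (Matrix.single a b 1 : Matrix (Fin n) (Fin n) ℂ) := by
  conv_lhs => rw [Matrix.matrix_eq_sum_single M]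
  simp

theorem differentiableAt_matrix_complex {E : Type*} [NormedAddCommGroup E] [NormedSpace ℂ E]
    {M : E → Matrix (Fin n) (Fin n) ℂ} {z : E}
    (h : ∀ a b, DifferentiableAt ℂ (fun y => M y a b) z) : DifferentiableAt ℂ M z := by
  rw [funext fun y => eq_sum_smul_single (M y)]
  exact DifferentiableAt.fun_sum fun a _ => DifferentiableAt.fun_sum fun b _ =>
    (h a b).smul_const _

theorem differentiableAt_matrix_real {E : Type*} [NormedAddCommGroup E] [NormedSpace ℝ E]
    {M : E → Matrix (Fin n) (Fin n) ℂ} {z : E}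
    (h : ∀ a b, DifferentiableAt ℝ (fun y => M y a b) z) : DifferentiableAt ℝ M z := by
  rw [funext fun y => eq_sum_smul_single (M y)]
  exact DifferentiableAt.fun_sum fun a _ => DifferentiableAt.fun_sum fun b _ =>
    (h a b).smul_const _

theorem hasDerivAt_matrix {M : ℝ → Matrix (Fin n) (Fin n) ℂ}
    {M' : Matrix (Fin n) (Fin n) ℂ} {t : ℝ}
    (h : ∀ a b, HasDerivAt (fun s => M s a b) (M' a b) t) : HasDerivAt M M' t := by
  rw [funext fun y => eq_sum_smul_single (M y), eq_sum_smul_single M']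
  exact HasDerivAt.fun_sum fun a _ => HasDerivAt.fun_sum fun b _ => (h a b).smul_const _

theorem differentiableAt_inv_entry {G : Cn n → Matrix (Fin n) (Fin n) ℂ} {z : Cn n}
    (h : ∀ a b, DifferentiableAt ℝ (fun y => G y a b) z) (hu : IsUnit (G z)) (a b : Fin n) :
    DifferentiableAt ℝ (fun y => (G y)⁻¹ a b) z := by
  have h1 : DifferentiableAt ℝ G z := differentiableAt_matrix_real h
  have h2 : DifferentiableAt ℝ (Ring.inverse : Matrix (Fin n) (Fin n) ℂ → _) (G z) := by
    obtain ⟨u, hu⟩ := hu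
    rw [← hu]
    exact (differentiableAt_inverse (𝕜 := ℝ) (x := u.val) u.isUnit)
  have h3 := ((entryCLM a b).restrictScalars ℝ).differentiableAt.comp z (h2.comp z h1)
  refine h3.congr_of_eventuallyEq (Eventually.of_forall fun y => ?_)
  simp only [Matrix.nonsing_inv_eq_ringInverse]
  rfl

variable {G : Cn n → Matrix (Fin n) (Fin n) ℂ} {U : Set (Cn n)}

/-- The matrix `∂_c G`. -/
def dzMatrix (G : Cn n → Matrix (Fin n) (Fin n) ℂ) (c : Fin n) (z : Cn n) :
    Matrix (Fin n) (Fin n) ℂ := Matrix.of fun a b => dz c (fun y => G y a b) z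

/-- The matrix `∂_c G * G⁻¹` of the Chern connection. -/
def chernMatrix (G : Cn n → Matrix (Fin n) (Fin n) ℂ) (c : Fin n) (z : Cn n) :
    Matrix (Fin n) (Fin n) ℂ := dzMatrix G c z * (G z)⁻¹

namespace IsFlatKahlerMatrix

theorem differentiableAt (h : IsFlatKahlerMatrix G U) {z : Cn n} (hz : z ∈ U) (a b : Fin n) :
    DifferentiableAt ℝ (fun y => G y a b) z :=
  (h.contDiffAt z hz a b).differentiableAt (by simp)

theorem chernMatrix_mul (h : IsFlatKahlerMatrix G U) {z : Cn n} (hz : z ∈ U) (c : Fin n) :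
    chernMatrix G c z * G z = dzMatrix G c z := by
  rw [chernMatrix, Matrix.mul_assoc, Matrix.nonsing_inv_mul _
    ((Matrix.isUnit_iff_isUnit_det _).1 (h.isUnit z hz)), Matrix.mul_one]

/-- Conjugating `G = Gᴴ` exchanges the two kinds of derivatives. -/
theorem dzbar_eq (h : IsFlatKahlerMatrix G U) {z : Cn n} (hz : z ∈ U) (a b c : Fin n) :
    dzbar c (fun y => G y a b) z = (dzMatrix G c z)ᴴ a b := by
  rw [Matrix.conjTranspose_apply, dzMatrix, Matrix.of_apply]
  have : (fun y => G y a b) =ᶠ[𝓝 z] fun y => conj (G y b a) := by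
    filter_upwards [h.isOpen.mem_nhds hz] with y hy
    conv_lhs => rw [← h.hermitian y hy]
    rfl
  rw [dzbar_congr this, dzbar_conj (h.differentiableAt hz b a)]
  rfl

theorem differentiableAt_chernMatrix_entry (h : IsFlatKahlerMatrix G U) {z : Cn n} (hz : z ∈ U)
    (c a b : Fin n) : DifferentiableAt ℝ (fun y => chernMatrix G c y a b) z := by
  simp only [chernMatrix, Matrix.mul_apply, dzMatrix, Matrix.of_apply]
  exact DifferentiableAt.fun_sum fun k _ =>
    ((contDiffAt_dz (h.contDiffAt z hz a k) c).differentiableAt (by simp)).mul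
      (differentiableAt_inv_entry (h.differentiableAt hz) (h.isUnit z hz) k b)

/-- Apply `∂_d̄` to `Γ_c G = ∂_c G`: the result is `(∂_d̄ Γ_c) G = ∂_d̄ ∂_c G - Γ_c ∂_d̄ G`. The
right side is the curvature, hence zero, and `G` is invertible. -/
theorem dzbar_chernMatrix (h : IsFlatKahlerMatrix G U) {z : Cn n} (hz : z ∈ U)
    (c d a b : Fin n) : dzbar d (fun y => chernMatrix G c y a b) z = 0 := by
  let D : Matrix (Fin n) (Fin n) ℂ := Matrix.of fun a b =>
    dzbar d (fun y => chernMatrix G c y a b) z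
  suffices hD : D * G z = 0 by
    have h0 : D = 0 := by
      have := congrArg (· * (G z)⁻¹) hD
      simpa [Matrix.mul_assoc, Matrix.mul_nonsing_inv _
        ((Matrix.isUnit_iff_isUnit_det _).1 (h.isUnit z hz))] using this
    exact congrFun (congrFun h0 a) b
  ext a b
  have h1 : (fun y => dz c (fun y => G y a b) y) =ᶠ[𝓝 z]
      fun y => ∑ k, chernMatrix G c y a k * G y k b := by
    filter_upwards [h.isOpen.mem_nhds hz] with y hy
    have := congrFun (congrFun (h.chernMatrix_mul hy c) a) b
    rw [Matrix.mul_apply] at this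
    exact this.symm
  have h2 := dzbar_congr h1 d
  rw [dzbar_sum _ (fun k _ => (h.differentiableAt_chernMatrix_entry hz c a k).fun_mul
    (h.differentiableAt hz k b))] at h2
  simp only [fun k => dzbar_mul (h.differentiableAt_chernMatrix_entry hz c a k)
    (h.differentiableAt hz k b) d, Finset.sum_add_distrib] at h2
  rw [dzbar_dz_comm (h.contDiffAt z hz a b), h.curvature z hz] at h2
  rw [Matrix.mul_apply, Matrix.zero_apply]
  refine add_eq_right.1 (h2.symm.trans ?_)
  refine Finset.sum_congr rfl fun k _ => ?_
  rw [chernMatrix, Matrix.mul_apply, Finset.sum_mul]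
  refine Finset.sum_congr rfl fun f _ => ?_
  rw [dzMatrix, Matrix.of_apply]
  ring

theorem differentiableAt_chernMatrix (h : IsFlatKahlerMatrix G U) {z : Cn n} (hz : z ∈ U)
    (c : Fin n) : DifferentiableAt ℂ (chernMatrix G c) z :=
  differentiableAt_matrix_complex fun a b =>
    differentiableAt_of_dzbar_eq_zero (h.differentiableAt_chernMatrix_entry hz c a b)
      fun d => h.dzbar_chernMatrix hz c d a b

/-- The `∂`-part of the derivative in direction `z` is `(∑ z_c Γ_c) G`; the `∂̄`-part is its
conjugate transpose. -/
theorem hasDerivAt_ray (h : IsFlatKahlerMatrix G U) {z : Cn n} {t : ℝ} (hz : t • z ∈ U) :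
    HasDerivAt (fun s : ℝ => G (s • z))
      ((∑ c, z c • chernMatrix G c (t • z)) * G (t • z)
        + G (t • z) * (∑ c, z c • chernMatrix G c (t • z))ᴴ) t := by
  refine hasDerivAt_matrix fun a b => ?_
  have h1 : HasDerivAt (fun s : ℝ => s • z) z t := by
    simpa using (hasDerivAt_id t).smul_const z
  have h2 := (h.differentiableAt hz a b).hasFDerivAt.comp_hasDerivAt t h1
  refine h2.congr_deriv ?_
  have h3 : G (t • z) * (∑ c, z c • chernMatrix G c (t • z))ᴴ =
      ((∑ c, z c • chernMatrix G c (t • z)) * G (t • z))ᴴ := by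
    rw [Matrix.conjTranspose_mul, h.hermitian _ hz]
  have h4 : (∑ c, z c • chernMatrix G c (t • z)) * G (t • z) =
      ∑ c, z c • dzMatrix G c (t • z) := by
    rw [Finset.sum_mul]
    refine Finset.sum_congr rfl fun c _ => ?_
    rw [Matrix.smul_mul, h.chernMatrix_mul hz]
  rw [h3, h4, fderiv_eq_sum_dz, Finset.sum_add_distrib, Matrix.add_apply]
  congr 1
  · simp [Matrix.sum_apply, dzMatrix]
  · simp only [h.dzbar_eq hz, Matrix.conjTranspose_sum, Matrix.conjTranspose_smul,
      Matrix.sum_apply, Matrix.smul_apply, smul_eq_mul]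
    rfl

/-- A flat Kähler metric is constant in a suitable holomorphic frame. -/
theorem exists_holomorphic_frame (h : IsFlatKahlerMatrix G U) (h0 : 0 ∈ U) :
    ∃ S : Cn n → Matrix (Fin n) (Fin n) ℂ, (∀ᶠ z in 𝓝 (0 : Cn n), ∀ a b,
      DifferentiableAt ℂ (fun y => S y a b) z) ∧
      ∀ᶠ z in 𝓝 (0 : Cn n), G z = S z * G 0 * (S z)ᴴ := by
  obtain ⟨R, hR, hRU⟩ := nhds_basis_closedBall.mem_iff.1 (h.isOpen.mem_nhds h0)
  obtain ⟨S, hS, hSG⟩ := exists_analyticAt_factorization (G := G) (τ := conjTransposeCLM n) hR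
    (fun A B => Matrix.conjTranspose_mul A B) Matrix.conjTranspose_one
    (fun c ζ hζ => h.differentiableAt_chernMatrix (hRU hζ) c)
    (fun z t hz => h.hasDerivAt_ray (hRU hz))
  refine ⟨S, ?_, hSG⟩
  filter_upwards [hS.eventually_analyticAt] with z hz i j
  exact (entryCLM i j).differentiableAt.comp z hz.differentiableAt

end IsFlatKahlerMatrix
end MatrixCalculus
end KahlerFrobenius

end

/-! ### From the holomorphic frame to flat coordinates. -/

noncomputable section

open Set MeasureTheory Metric Filter
open scoped Real Topology unitInterval Manifold ContDiff Bundle ComplexConjugate Matrix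

namespace KahlerFrobenius
variable {n : ℕ}

namespace IsFlatKahlerMatrix

variable {G : Cn n → Matrix (Fin n) (Fin n) ℂ} {U : Set (Cn n)}

/-- The entries of `Sᴴ` are antiholomorphic, so `∂_c` acts only on the left factor. -/
theorem dz_eq_of_frame {S : Cn n → Matrix (Fin n) (Fin n) ℂ} {H : Matrix (Fin n) (Fin n) ℂ}
    {z : Cn n} (hS : ∀ a b, DifferentiableAt ℂ (fun y => S y a b) z)
    (hSG : ∀ᶠ y in 𝓝 z, G y = S y * H * (S y)ᴴ) (a b c : Fin n) :
    dz c (fun y => G y a b) z =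
      ∑ i, fderiv ℂ (fun y => S y a i) z (e c) * (H * (S z)ᴴ) i b := by
  have h1 : (fun y => G y a b) =ᶠ[𝓝 z] fun y => ∑ i, S y a i * ∑ j, H i j * conj (S y b j) := by
    filter_upwards [hSG] with y hy
    rw [hy, Matrix.mul_assoc, Matrix.mul_apply]
    simp only [Matrix.mul_apply, Matrix.conjTranspose_apply]
    rfl
  have hSr : ∀ a b, DifferentiableAt ℝ (fun y => S y a b) z :=
    fun a b => (hS a b).restrictScalars ℝ
  have hSc : ∀ a b, DifferentiableAt ℝ (fun y => conj (S y a b)) z := fun a b =>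
    Complex.conjCLE.toContinuousLinearMap.differentiableAt.comp z (hSr a b)
  have hin : ∀ i, DifferentiableAt ℝ (fun y => ∑ j, H i j * conj (S y b j)) z := fun i =>
    DifferentiableAt.fun_sum fun j _ => (hSc b j).const_mul _
  rw [dz_congr h1, dz_sum _ (fun i _ => (hSr a i).fun_mul (hin i))]
  refine Finset.sum_congr rfl fun i _ => ?_
  have h2 : dz c (fun y => ∑ j, H i j * conj (S y b j)) z = 0 := by
    rw [dz_sum _ (fun j _ => (hSc b j).const_mul _)]
    refine Finset.sum_eq_zero fun j _ => ?_
    rw [dz_mul (differentiableAt_const _) (hSc b j), dz_const, dz_conj (hSr b j),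
      dzbar_of_differentiableAt (hS b j)]
    simp
  rw [dz_mul (hSr a i) (hin i), h2, mul_zero, add_zero, dz_of_differentiableAt (hS a i)]
  simp only [Matrix.mul_apply, Matrix.conjTranspose_apply]
  rfl

/-- The Kähler identity `∂_c G_{ab} = ∂_a G_{cb}` says that the row vector `∂_c S_a - ∂_a S_c` is
annihilated by `H Sᴴ`, which is invertible because `G` is. Thus the forms `∑ S_{ai} dzᵃ` are closed.
-/
theorem fderiv_frame_symm (h : IsFlatKahlerMatrix G U) {S : Cn n → Matrix (Fin n) (Fin n) ℂ}
    {H : Matrix (Fin n) (Fin n) ℂ} {z : Cn n} (hz : z ∈ U)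
    (hS : ∀ a b, DifferentiableAt ℂ (fun y => S y a b) z)
    (hSG : ∀ᶠ y in 𝓝 z, G y = S y * H * (S y)ᴴ) (a c i : Fin n) :
    fderiv ℂ (fun y => S y a i) z (e c) = fderiv ℂ (fun y => S y c i) z (e a) := by
  have hu : IsUnit (H * (S z)ᴴ).det := by
    have h1 := (Matrix.isUnit_iff_isUnit_det _).1 (h.isUnit z hz)
    rw [hSG.self_of_nhds, Matrix.mul_assoc, Matrix.det_mul] at h1
    exact isUnit_of_mul_isUnit_right h1
  let v : Fin n → ℂ := fun i =>
    fderiv ℂ (fun y => S y a i) z (e c) - fderiv ℂ (fun y => S y c i) z (e a)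
  have hv : v ᵥ* (H * (S z)ᴴ) = 0 := by
    ext b
    have := h.closed z hz a b c
    rw [dz_eq_of_frame hS hSG, dz_eq_of_frame hS hSG, ← sub_eq_zero, ← Finset.sum_sub_distrib]
      at this
    simp only [Matrix.vecMul, dotProduct, v, sub_mul, Pi.zero_apply]
    exact this
  have hv0 : v = 0 := by
    have := congrArg (· ᵥ* (H * (S z)ᴴ)⁻¹) hv
    simpa [Matrix.vecMul_vecMul, Matrix.mul_nonsing_inv _ hu] using this
  exact sub_eq_zero.1 (congrFun hv0 i)

/-- Holomorphic functions `w` whose differentials are a frame in which the metric is constant. -/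
theorem exists_flat_map (h : IsFlatKahlerMatrix G U) (h0 : 0 ∈ U) :
    ∃ w : Cn n → Cn n, AnalyticAt ℂ w 0 ∧ (∃ w' : Cn n ≃L[ℂ] Cn n, HasFDerivAt w (w' : Cn n →L[ℂ] Cn n) 0) ∧
      ∀ᶠ z in 𝓝 (0 : Cn n), ∀ a b, G z a b =
        ∑ i, ∑ j, fderiv ℂ w z (e a) i * G 0 i j * conj (fderiv ℂ w z (e b) j) := by
  obtain ⟨S, hS, hSG⟩ := h.exists_holomorphic_frame h0
  obtain ⟨R, hR, hRS⟩ := Metric.eventually_nhds_iff_ball.1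
    ((hS.and hSG).and (h.isOpen.mem_nhds h0))
  let pr : Fin n → (Cn n →L[ℂ] ℂ) := fun a => ContinuousLinearMap.proj a
  let om : Fin n → Cn n → (Cn n →L[ℂ] ℂ) := fun i z =>
    ∑ a, S z a i • pr a
  have hom : ∀ i, ∀ z ∈ ball (0 : Cn n) R, HasFDerivAt (om i)
      (∑ a, (fderiv ℂ (fun y => S y a i) z).smulRight
        (pr a)) z := by
    intro i z hz
    exact HasFDerivAt.fun_sum fun a _ => ((hRS z hz).1.1 a i).hasFDerivAt.smul_const (pr a)
  have hsum : ∀ i, ∀ z ∈ ball (0 : Cn n) R, ∀ x y : Cn n,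
      (∑ a, (fderiv ℂ (fun y => S y a i) z).smulRight
        (pr a)) x y =
      ∑ a, ∑ c, x c * y a * fderiv ℂ (fun y => S y a i) z (e c) := by
    intro i z hz x y
    simp only [sum_apply, ContinuousLinearMap.smulRight_apply,
      smul_apply, ContinuousLinearMap.proj_apply, pr, smul_eq_mul]
    refine Finset.sum_congr rfl fun a _ => ?_
    have hx : x = ∑ c, x c • (e c : Cn n) := by
      simpa [e, ← Pi.single_smul] using (Finset.univ_sum_single x).symm
    conv_lhs => rw [hx, map_sum, Finset.sum_mul]
    refine Finset.sum_congr rfl fun c _ => ?_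
    rw [map_smul, smul_eq_mul]
    ring
  have hsymm : ∀ i, ∀ z ∈ ball (0 : Cn n) R, ∀ x y : Cn n,
      fderiv ℝ (om i) z x y = fderiv ℝ (om i) z y x := by
    intro i z hz x y
    rw [(hom i z hz).differentiableAt.fderiv_restrictScalars ℝ, (hom i z hz).fderiv]
    simp only [ContinuousLinearMap.coe_restrictScalars', hsum i z hz]
    rw [Finset.sum_comm]
    refine Finset.sum_congr rfl fun a _ => Finset.sum_congr rfl fun c _ => ?_
    have hSz : ∀ᶠ y in 𝓝 z, G y = S y * G 0 * (S y)ᴴ := by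
      filter_upwards [isOpen_ball.mem_nhds hz] with y hy using (hRS y hy).1.2
    rw [h.fderiv_frame_symm (hRS z hz).2 (hRS z hz).1.1 hSz a c i]
    ring
  -- The Poincaré lemma on a ball. The differentials `om i z` are complex linear, so the primitives
  -- are holomorphic.
  have hf : ∀ i, ∃ f : Cn n → ℂ, ∀ z ∈ ball (0 : Cn n) R, HasFDerivAt f (om i z) z := fun i =>
    (convex_ball (0 : Cn n) R).exists_forall_hasFDerivAt_of_fderiv_symmetric isOpen_ball
      (fun z hz => ((hom i z hz).differentiableAt.restrictScalars ℝ).differentiableWithinAt)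
      (hsymm i)
  choose f hf using hf
  let w : Cn n → Cn n := fun z i => f i z
  have hw : ∀ z ∈ ball (0 : Cn n) R, HasFDerivAt w (ContinuousLinearMap.pi fun i => om i z) z :=
    fun z hz => hasFDerivAt_pi.2 fun i => hf i z hz
  have hwS : ∀ z ∈ ball (0 : Cn n) R, ∀ a i, fderiv ℂ w z (e a) i = S z a i := by
    intro z hz a i
    rw [(hw z hz).fderiv]
    simp [om, pr, e, Pi.single_apply]
  have hb0 : (0 : Cn n) ∈ ball (0 : Cn n) R := mem_ball_self hR
  refine ⟨w, ?_, ?_, ?_⟩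
  · exact DifferentiableOn.analyticAt_of_isOpen_pi (U := ball 0 R)
      (fun z hz => (hw z hz).differentiableAt.differentiableWithinAt) isOpen_ball hb0
  · have hu : IsUnit (S 0).det := by
      have h1 := (Matrix.isUnit_iff_isUnit_det _).1 (h.isUnit 0 h0)
      rw [(hRS 0 hb0).1.2, Matrix.mul_assoc, Matrix.det_mul] at h1
      exact isUnit_of_mul_isUnit_left h1
    have hinj : Function.Injective (ContinuousLinearMap.pi fun i => om i 0 : Cn n →L[ℂ] Cn n) := by
      rw [injective_iff_map_eq_zero]
      intro v hv
      have h1 : v ᵥ* S 0 = 0 := by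
        ext i
        have := congrFun hv i
        simpa [om, pr, Matrix.vecMul, dotProduct, mul_comm] using this
      have := congrArg (· ᵥ* (S 0)⁻¹) h1
      simpa [Matrix.vecMul_vecMul, Matrix.mul_nonsing_inv _ hu] using this
    let w' := (LinearEquiv.ofInjectiveEndo
      (ContinuousLinearMap.pi fun i => om i 0 : Cn n →L[ℂ] Cn n).toLinearMap
      hinj).toContinuousLinearEquiv
    refine ⟨w', ?_⟩
    have : (w' : Cn n →L[ℂ] Cn n) = ContinuousLinearMap.pi fun i => om i 0 := by
      ext1 v; rfl
    rw [this]
    exact hw 0 hb0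
  · filter_upwards [isOpen_ball.mem_nhds hb0] with z hz a b
    simp only [hwS z hz]
    rw [(hRS z hz).1.2, Matrix.mul_apply]
    simp only [Matrix.mul_apply, Matrix.conjTranspose_apply, Finset.sum_mul]
    rw [Finset.sum_comm]
    rfl

/-- A flat Kähler metric is constant in suitable holomorphic coordinates. -/
theorem exists_flat_coordinates (h : IsFlatKahlerMatrix G U) (h0 : 0 ∈ U) :
    ∃ w : OpenPartialHomeomorph (Cn n) (Cn n), 0 ∈ w.source ∧ w.source ⊆ U ∧
      ContDiffOn ℂ ω w w.source ∧ ContDiffOn ℂ ω w.symm w.target ∧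
      ∀ z ∈ w.source, ∀ a b, G z a b =
        ∑ i, ∑ j, fderiv ℂ w z (e a) i * G 0 i j * conj (fderiv ℂ w z (e b) j) := by
  obtain ⟨w, hw, ⟨w', hw'⟩, hwG⟩ := h.exists_flat_map h0
  have hwc : ContDiffAt ℂ ω w 0 := hw.contDiffAt
  let W := hwc.toOpenPartialHomeomorph w hw' (by simp)
  have hWw : ∀ z, W z = w z := fun z => rfl
  have h0W : (0 : Cn n) ∈ W.source := hwc.mem_toOpenPartialHomeomorph_source hw' (by simp)
  -- Invertibility of the differential is needed at every point of the domain, not only at `0`, to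
  -- make the inverse of class `ω` on its whole target.
  have hgood : ∀ᶠ z in 𝓝 (0 : Cn n), AnalyticAt ℂ w z ∧
      (∃ L : Cn n ≃L[ℂ] Cn n, (L : Cn n →L[ℂ] Cn n) = fderiv ℂ w z) ∧ z ∈ U ∧
      ∀ a b, G z a b =
        ∑ i, ∑ j, fderiv ℂ w z (e a) i * G 0 i j * conj (fderiv ℂ w z (e b) j) := by
    have h1 : ∀ᶠ z in 𝓝 (0 : Cn n), fderiv ℂ w z ∈ range ((↑) : (Cn n ≃L[ℂ] Cn n) → _) := by
      refine hw.fderiv.continuousAt.eventually_mem ?_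
      rw [hw'.fderiv]
      exact ContinuousLinearEquiv.nhds w'
    filter_upwards [hw.eventually_analyticAt, h1, h.isOpen.mem_nhds h0, hwG] with z h1 h2 h3 h4
      using ⟨h1, h2, h3, h4⟩
  obtain ⟨V, hV, hVo, h0V⟩ := _root_.eventually_nhds_iff.1 hgood
  refine ⟨W.restrOpen V hVo, ⟨h0W, h0V⟩, fun z hz => (hV z hz.2).2.2.1, ?_, ?_, ?_⟩
  · exact fun z hz => (hV z hz.2).1.contDiffAt.contDiffWithinAt
  · intro y hy
    have hy' := (W.restrOpen V hVo).map_target hy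
    obtain ⟨L, hL⟩ := (hV _ hy'.2).2.1
    have hd : HasFDerivAt (W.restrOpen V hVo) (L : Cn n →L[ℂ] Cn n)
        ((W.restrOpen V hVo).symm y) := by
      rw [hL]
      exact (hV _ hy'.2).1.differentiableAt.hasFDerivAt
    exact ((W.restrOpen V hVo).contDiffAt_symm hy hd
      (hV _ hy'.2).1.contDiffAt).contDiffWithinAt
  · exact fun z hz => (hV z hz.2).2.2.2

end IsFlatKahlerMatrix
end KahlerFrobenius

end

/-! ### Differentials of holomorphic charts and coordinate fields. -/

noncomputable section

open Set Metric Filter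
open scoped Real Topology Manifold ContDiff Bundle ComplexConjugate Matrix

namespace KahlerFrobenius

set_option linter.unusedSectionVars false

section ChartCalculus

variable {n : ℕ} {M : Type*} [TopologicalSpace M] [ChartedSpace (Cn n) M]

/-- The differential of a chart. -/
def chartDeriv (φ : OpenPartialHomeomorph M (Cn n)) (x : M) : T n x →L[ℝ] Cn n :=
  mfderiv 𝓘(ℝ, Cn n) 𝓘(ℝ, Cn n) φ x

theorem coordField_eq_inverse (φ : OpenPartialHomeomorph M (Cn n)) (v : Cn n) (x : M) :
    coordField φ v x = (chartDeriv φ x).inverse v := rfl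

theorem J_apply (x : M) (X : T n x) : (J x X : Cn n) = Complex.I • (show Cn n from X) := rfl

variable [IsManifold 𝓘(ℂ, Cn n) ω M] {φ ψ : OpenPartialHomeomorph M (Cn n)}

theorem mem_maximalAtlas_real (hφ : φ ∈ holomorphicCharts n M) :
    φ ∈ IsManifold.maximalAtlas 𝓘(ℝ, Cn n) ω M := by
  refine StructureGroupoid.maximalAtlas_mono ?_ hφ
  intro f hf
  change f ∈ contDiffGroupoid ω 𝓘(ℂ, Cn n) at hf
  change f ∈ contDiffGroupoid ω 𝓘(ℝ, Cn n)
  rw [contDiffGroupoid, mem_groupoid_of_pregroupoid] at hf ⊢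
  exact ⟨ContDiffOn.restrict_scalars ℝ hf.1, ContDiffOn.restrict_scalars ℝ hf.2⟩

theorem contMDiffOn_chart_real (hφ : φ ∈ holomorphicCharts n M) :
    ContMDiffOn 𝓘(ℝ, Cn n) 𝓘(ℝ, Cn n) ω φ φ.source :=
  contMDiffOn_of_mem_maximalAtlas (mem_maximalAtlas_real hφ)

theorem contMDiffAt_chart_real (hφ : φ ∈ holomorphicCharts n M) {x : M} (hx : x ∈ φ.source) :
    ContMDiffAt 𝓘(ℝ, Cn n) 𝓘(ℝ, Cn n) ω φ x :=
  contMDiffAt_of_mem_maximalAtlas (mem_maximalAtlas_real hφ) hx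

theorem contMDiffAt_chart_symm_real (hφ : φ ∈ holomorphicCharts n M) {z : Cn n}
    (hz : z ∈ φ.target) : ContMDiffAt 𝓘(ℝ, Cn n) 𝓘(ℝ, Cn n) ω φ.symm z :=
  contMDiffAt_symm_of_mem_maximalAtlas (mem_maximalAtlas_real hφ) hz

theorem mdifferentiable_chart_real (hφ : φ ∈ holomorphicCharts n M) :
    φ.MDifferentiable 𝓘(ℝ, Cn n) 𝓘(ℝ, Cn n) :=
  ⟨(contMDiffOn_chart_real hφ).mdifferentiableOn (by simp),
    (contMDiffOn_symm_of_mem_maximalAtlas (mem_maximalAtlas_real hφ)).mdifferentiableOn (by simp)⟩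

theorem isInvertible_chartDeriv (hφ : φ ∈ holomorphicCharts n M) {x : M} (hx : x ∈ φ.source) :
    (chartDeriv φ x).IsInvertible :=
  ⟨(mdifferentiable_chart_real hφ).mfderiv hx, rfl⟩

theorem chartDeriv_coordField (hφ : φ ∈ holomorphicCharts n M) {x : M} (hx : x ∈ φ.source)
    (v : Cn n) : chartDeriv φ x (coordField φ v x) = v :=
  (isInvertible_chartDeriv hφ hx).self_apply_inverse v

theorem coordField_chartDeriv (hφ : φ ∈ holomorphicCharts n M) {x : M} (hx : x ∈ φ.source)
    (X : T n x) : coordField φ (chartDeriv φ x X) x = X :=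
  (isInvertible_chartDeriv hφ hx).inverse_apply_self X

theorem chartDeriv_injective (hφ : φ ∈ holomorphicCharts n M) {x : M} (hx : x ∈ φ.source) :
    Function.Injective (chartDeriv φ x) :=
  (isInvertible_chartDeriv hφ hx).injective

theorem contDiffAt_transition (hφ : φ ∈ holomorphicCharts n M) (hψ : ψ ∈ holomorphicCharts n M)
    {z : Cn n} (hz : z ∈ φ.target) (hz' : φ.symm z ∈ ψ.source) :
    ContDiffAt ℂ ω (ψ ∘ φ.symm) z := by
  have h := IsManifold.compatible_of_mem_maximalAtlas (I := 𝓘(ℂ, Cn n)) hφ hψ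
  rw [contDiffGroupoid, mem_groupoid_of_pregroupoid] at h
  have h1 : ContDiffOn ℂ ω (ψ ∘ φ.symm) (φ.symm.trans ψ).source := by
    simpa [contDiffPregroupoid] using h.1
  exact h1.contDiffAt ((φ.symm.trans ψ).open_source.mem_nhds (by simp [hz, hz']))

theorem differentiableAt_transition_real (hφ : φ ∈ holomorphicCharts n M)
    (hψ : ψ ∈ holomorphicCharts n M) {z : Cn n} (hz : z ∈ φ.target) (hz' : φ.symm z ∈ ψ.source) :
    DifferentiableAt ℝ (ψ ∘ φ.symm) z :=
  ((contDiffAt_transition hφ hψ hz hz').differentiableAt (by simp)).restrictScalars ℝ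

theorem hasMFDerivAt_chart (hφ : φ ∈ holomorphicCharts n M) {x : M} (hx : x ∈ φ.source) :
    HasMFDerivAt 𝓘(ℝ, Cn n) 𝓘(ℝ, Cn n) φ x (chartDeriv φ x) :=
  ((contMDiffAt_chart_real hφ hx).mdifferentiableAt (by simp)).hasMFDerivAt

theorem hasMFDerivAt_comp_chart {F : Type*} [NormedAddCommGroup F] [NormedSpace ℝ F]
    (hφ : φ ∈ holomorphicCharts n M) {x : M} (hx : x ∈ φ.source) {f : Cn n → F}
    (hf : DifferentiableAt ℝ f (φ x)) :
    HasMFDerivAt 𝓘(ℝ, Cn n) 𝓘(ℝ, F) (f ∘ φ) x ((fderiv ℝ f (φ x)).comp (chartDeriv φ x)) :=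
  HasMFDerivAt.comp x hf.hasFDerivAt.hasMFDerivAt (hasMFDerivAt_chart hφ hx)

theorem mvfderiv_comp_chart {F : Type*} [NormedAddCommGroup F] [NormedSpace ℝ F]
    (hφ : φ ∈ holomorphicCharts n M) {x : M} (hx : x ∈ φ.source) {f : Cn n → F}
    (hf : DifferentiableAt ℝ f (φ x)) (V : T n x) :
    mvfderiv 𝓘(ℝ, Cn n) (f ∘ φ) x V = fderiv ℝ f (φ x) (chartDeriv φ x V) := by
  rw [mvfderiv, (hasMFDerivAt_comp_chart hφ hx hf).mfderiv]
  rfl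

theorem chartDeriv_change (hφ : φ ∈ holomorphicCharts n M) (hψ : ψ ∈ holomorphicCharts n M)
    {x : M} (hx : x ∈ φ.source) (hx' : x ∈ ψ.source) (X : T n x) :
    chartDeriv ψ x X = fderiv ℝ (ψ ∘ φ.symm) (φ x) (chartDeriv φ x X) := by
  have hd : DifferentiableAt ℝ (ψ ∘ φ.symm) (φ x) :=
    differentiableAt_transition_real hφ hψ (φ.map_source hx) (by rwa [φ.left_inv hx])
  have h1 := hasMFDerivAt_comp_chart hφ hx hd
  have h2 : HasMFDerivAt 𝓘(ℝ, Cn n) 𝓘(ℝ, Cn n) ψ x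
      ((fderiv ℝ (ψ ∘ φ.symm) (φ x)).comp (chartDeriv φ x)) := by
    refine h1.congr_of_eventuallyEq ?_
    filter_upwards [φ.open_source.mem_nhds hx] with y hy
    simp [φ.left_inv hy]
  rw [chartDeriv, h2.mfderiv]
  rfl

theorem chartDeriv_coordField_change (hφ : φ ∈ holomorphicCharts n M)
    (hψ : ψ ∈ holomorphicCharts n M) {x : M} (hx : x ∈ φ.source) (hx' : x ∈ ψ.source) (v : Cn n) :
    chartDeriv ψ x (coordField φ v x) = fderiv ℝ (ψ ∘ φ.symm) (φ x) v := by
  rw [chartDeriv_change hφ hψ hx hx', chartDeriv_coordField hφ hx]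

theorem chartAt_mem_holomorphicCharts (x : M) : chartAt (Cn n) x ∈ holomorphicCharts n M :=
  IsManifold.chart_mem_maximalAtlas x

/-- `T n x` is a copy of `ℂⁿ` through the preferred chart at `x`, and `J` is multiplication by `i`
there. In this identification the differential of `φ` is that of a holomorphic transition map, hence
complex linear. -/
theorem chartDeriv_J (hφ : φ ∈ holomorphicCharts n M) {x : M} (hx : x ∈ φ.source) (X : T n x) :
    chartDeriv φ x (J x X) = Complex.I • chartDeriv φ x X := by
  have hc := chartAt_mem_holomorphicCharts (n := n) x
  have hd : DifferentiableAt ℂ (φ ∘ (chartAt (Cn n) x).symm) (chartAt (Cn n) x x) :=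
    (contDiffAt_transition hc hφ (mem_chart_target _ x)
      (by simpa using hx)).differentiableAt (by simp)
  have h1 : ∀ Y : T n x, chartDeriv φ x Y =
      fderiv ℂ (φ ∘ (chartAt (Cn n) x).symm) (chartAt (Cn n) x x) Y := by
    intro Y
    rw [chartDeriv, MDifferentiableAt.mfderiv
      ((contMDiffAt_chart_real hφ hx).mdifferentiableAt (by simp))]
    simp only [mfld_simps, writtenInExtChartAt, fderivWithin_univ]
    have := hd.fderiv_restrictScalars ℝ
    simp only [Function.comp_def] at this ⊢
    erw [this]
    rfl
  rw [h1, h1, J_apply, map_smul]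

theorem coordField_I_smul (hφ : φ ∈ holomorphicCharts n M) {x : M} (hx : x ∈ φ.source)
    (v : Cn n) : coordField φ (Complex.I • v) x = J x (coordField φ v x) := by
  apply chartDeriv_injective hφ hx
  rw [chartDeriv_J hφ hx, chartDeriv_coordField hφ hx, chartDeriv_coordField hφ hx]

theorem trans_mem_holomorphicCharts (hφ : φ ∈ holomorphicCharts n M)
    {w : OpenPartialHomeomorph (Cn n) (Cn n)} (hw : ContDiffOn ℂ ω w w.source)
    (hw' : ContDiffOn ℂ ω w.symm w.target) : φ.trans w ∈ holomorphicCharts n M := by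
  apply OpenPartialHomeomorph.mem_maximalAtlas_of_contMDiffOn
  · exact hw.contMDiffOn.comp ((contMDiffOn_of_mem_maximalAtlas hφ).mono (by
      rw [OpenPartialHomeomorph.trans_source]; exact inter_subset_left)) (by
      rw [OpenPartialHomeomorph.trans_source]; exact fun x hx => hx.2)
  · exact (contMDiffOn_symm_of_mem_maximalAtlas hφ).comp (hw'.contMDiffOn.mono (by
      rw [OpenPartialHomeomorph.trans_target]; exact inter_subset_left)) (by
      rw [OpenPartialHomeomorph.trans_target]; exact fun x hx => hx.2)

theorem contMDiffAt_coordField (hφ : φ ∈ holomorphicCharts n M) {x : M} (hx : x ∈ φ.source)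
    (v : Cn n) : ContMDiffAt 𝓘(ℝ, Cn n) (𝓘(ℝ, Cn n).prod 𝓘(ℝ, Cn n)) ∞
      (fun y => (⟨y, coordField φ v y⟩ : TangentBundle 𝓘(ℝ, Cn n) M)) x := by
  refine ContMDiffAt.mpullback_vectorField_preimage (n := ω) ?_ (contMDiffAt_chart_real hφ hx)
    (isInvertible_chartDeriv hφ hx) (by simp)
  exact contMDiffAt_vectorSpace_iff_contDiffAt.2 contDiffAt_const

end ChartCalculus
end KahlerFrobenius

end

/-! ### The metric in holomorphic coordinates and its Hermitian matrix. -/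

noncomputable section

open Set Metric Filter
open scoped Real Topology Manifold ContDiff Bundle ComplexConjugate Matrix

namespace KahlerFrobenius

section MetricForm

variable {n : ℕ} {M : Type*} [TopologicalSpace M] [ChartedSpace (Cn n) M]
  [IsManifold 𝓘(ℂ, Cn n) ω M] {φ ψ : OpenPartialHomeomorph M (Cn n)}

/-- The metric in the coordinates `φ`, as a bilinear form on `ℂⁿ`. -/
def metricForm (g : Metric n M) (φ : OpenPartialHomeomorph M (Cn n)) (z : Cn n) :
    Cn n →ₗ[ℝ] Cn n →ₗ[ℝ] ℝ :=
  LinearMap.mk₂ ℝ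
    (fun u v => g.inner (φ.symm z) (coordField φ u (φ.symm z)) (coordField φ v (φ.symm z)))
    (fun u u' v => by simp only [coordField_eq_inverse, map_add, add_apply])
    (fun c u v => by simp only [coordField_eq_inverse, map_smul, smul_apply])
    (fun u v v' => by simp only [coordField_eq_inverse, map_add])
    (fun c u v => by simp only [coordField_eq_inverse, map_smul])

variable {g : Metric n M}

theorem metricForm_apply (z u v : Cn n) : metricForm g φ z u v =
    g.inner (φ.symm z) (coordField φ u (φ.symm z)) (coordField φ v (φ.symm z)) := rfl

theorem metricForm_comm (z u v : Cn n) : metricForm g φ z u v = metricForm g φ z v u :=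
  g.symm _ _ _

theorem inner_eq_metricForm (hφ : φ ∈ holomorphicCharts n M) {x : M} (hx : x ∈ φ.source)
    (X Y : T n x) : g.inner x X Y = metricForm g φ (φ x) (chartDeriv φ x X) (chartDeriv φ x Y) := by
  -- The base point is generalized because `φ.symm (φ x) = x` cannot be rewritten inside dependent
  -- tangent spaces.
  have h : ∀ y (hy : y = x) , g.inner x X Y =
      g.inner y (coordField φ (chartDeriv φ x X) y) (coordField φ (chartDeriv φ x Y) y) := by
    rintro y rfl
    rw [coordField_chartDeriv hφ hx, coordField_chartDeriv hφ hx]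
  exact h _ (φ.left_inv hx)

theorem metricForm_pos (hφ : φ ∈ holomorphicCharts n M) {z : Cn n} (hz : z ∈ φ.target)
    {u : Cn n} (hu : u ≠ 0) : 0 < metricForm g φ z u u := by
  refine g.pos _ _ fun h => hu ?_
  rw [← chartDeriv_coordField hφ (φ.map_target hz) u, h, map_zero]

theorem metricForm_change (hφ : φ ∈ holomorphicCharts n M) (hψ : ψ ∈ holomorphicCharts n M)
    {z : Cn n} (hz : z ∈ φ.target) (hz' : φ.symm z ∈ ψ.source) (u v : Cn n) :
    metricForm g φ z u v = metricForm g ψ (ψ (φ.symm z)) (fderiv ℝ (ψ ∘ φ.symm) z u)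
      (fderiv ℝ (ψ ∘ φ.symm) z v) := by
  have hx := φ.map_target hz
  rw [metricForm_apply, inner_eq_metricForm hψ hz', chartDeriv_coordField_change hφ hψ hx hz',
    chartDeriv_coordField_change hφ hψ hx hz', φ.right_inv hz]

theorem metricForm_I_smul (hg : IsKahler g) (hφ : φ ∈ holomorphicCharts n M) {z : Cn n}
    (hz : z ∈ φ.target) (u v : Cn n) :
    metricForm g φ z (Complex.I • u) (Complex.I • v) = metricForm g φ z u v := by
  rw [metricForm_apply, coordField_I_smul hφ (φ.map_target hz),
    coordField_I_smul hφ (φ.map_target hz), hg.hermitian, metricForm_apply]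

theorem metricForm_I_smul_left (hg : IsKahler g) (hφ : φ ∈ holomorphicCharts n M) {z : Cn n}
    (hz : z ∈ φ.target) (u v : Cn n) :
    metricForm g φ z (Complex.I • u) v = - metricForm g φ z u (Complex.I • v) := by
  rw [← metricForm_I_smul hg hφ hz, smul_smul, Complex.I_mul_I, neg_one_smul, map_neg,
    LinearMap.neg_apply]

theorem fundamentalForm_eq (hφ : φ ∈ holomorphicCharts n M) {z : Cn n}
    (hz : z ∈ φ.target) (u v : Cn n) :
    fundamentalForm g φ u v z = metricForm g φ z u (Complex.I • v) := by
  rw [metricForm_apply, coordField_I_smul hφ (φ.map_target hz), fundamentalForm]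

theorem contMDiffAt_inner {x : M} {X Y : ∀ y : M, T n y}
    (hX : ContMDiffAt 𝓘(ℝ, Cn n) (𝓘(ℝ, Cn n).prod 𝓘(ℝ, Cn n)) ∞
      (fun y => (⟨y, X y⟩ : TangentBundle 𝓘(ℝ, Cn n) M)) x)
    (hY : ContMDiffAt 𝓘(ℝ, Cn n) (𝓘(ℝ, Cn n).prod 𝓘(ℝ, Cn n)) ∞
      (fun y => (⟨y, Y y⟩ : TangentBundle 𝓘(ℝ, Cn n) M)) x) :
    ContMDiffAt 𝓘(ℝ, Cn n) 𝓘(ℝ) ∞ (fun y => g.inner y (X y) (Y y)) x := by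
  have h1 := g.contMDiff x
  have h : ContMDiffAt 𝓘(ℝ, Cn n) (𝓘(ℝ, Cn n).prod 𝓘(ℝ)) ∞
      (fun y => Bundle.TotalSpace.mk' ℝ (E := Bundle.Trivial M ℝ) y (g.inner y (X y) (Y y))) x :=
    ContMDiffAt.clm_bundle_apply₂ (F₁ := Cn n) (F₂ := Cn n) h1 hX hY
  rw [Bundle.contMDiffAt_totalSpace] at h
  exact h.2

theorem contDiffAt_metricForm (hφ : φ ∈ holomorphicCharts n M) {z : Cn n} (hz : z ∈ φ.target)
    (u v : Cn n) : ContDiffAt ℝ ∞ (fun y => metricForm g φ y u v) z := by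
  have hx := φ.map_target hz
  have h := (contMDiffAt_inner (g := g) (contMDiffAt_coordField hφ hx u)
    (contMDiffAt_coordField hφ hx v)).comp z
      ((contMDiffAt_chart_symm_real hφ hz).of_le (by simp))
  exact contMDiffAt_iff_contDiffAt.1 h

/-- The Hermitian form whose matrix is `metricMatrix`. -/
def hermitianForm (hg : IsKahler g) (hφ : φ ∈ holomorphicCharts n M) {z : Cn n}
    (hz : z ∈ φ.target) : Cn n →ₗ[ℂ] Cn n →ₛₗ[starRingEnd ℂ] ℂ :=
  LinearMap.mk₂'ₛₗ (RingHom.id ℂ) (starRingEnd ℂ)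
    (fun u v => ((metricForm g φ z u v : ℂ) + Complex.I * metricForm g φ z u (Complex.I • v)) / 2)
    (fun u u' v => by simp only [map_add, LinearMap.add_apply, Complex.ofReal_add]; ring)
    (fun c u v => by
      have hc : c • u = c.re • u + c.im • (Complex.I • u) := by
        ext i; simp [Complex.ext_iff]; ring_nf
      rw [hc]
      simp only [map_add, map_smul, LinearMap.add_apply, LinearMap.smul_apply,
        metricForm_I_smul hg hφ hz, metricForm_I_smul_left hg hφ hz, smul_eq_mul,
        RingHom.id_apply, Complex.ofReal_add, Complex.ofReal_mul, Complex.ofReal_neg]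
      conv_rhs => rw [← Complex.re_add_im c]
      ring_nf; simp only [Complex.I_sq]; ring)
    (fun u v v' => by simp only [smul_add, map_add, Complex.ofReal_add]; ring)
    (fun c u v => by
      have hc : c • v = c.re • v + c.im • (Complex.I • v) := by
        ext i; simp [Complex.ext_iff]; ring_nf
      have hc' : Complex.I • c • v = c.re • (Complex.I • v) - c.im • v := by
        ext i; simp [Complex.ext_iff]; ring_nf
      rw [hc', hc]
      simp only [map_add, map_sub, map_smul, smul_eq_mul,
        Complex.ofReal_add, Complex.ofReal_sub, Complex.ofReal_mul]
      conv_rhs => rw [← Complex.re_add_im c]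
      simp only [map_add, map_mul, Complex.conj_ofReal, Complex.conj_I]
      ring_nf; simp only [Complex.I_sq]; ring)

theorem hermitianForm_apply (hg : IsKahler g) (hφ : φ ∈ holomorphicCharts n M) {z : Cn n}
    (hz : z ∈ φ.target) (u v : Cn n) : hermitianForm hg hφ hz u v =
    ((metricForm g φ z u v : ℂ) + Complex.I * metricForm g φ z u (Complex.I • v)) / 2 := rfl

/-- By `J`-invariance the four terms of the bilinear extension coincide in pairs. -/
theorem metricMatrix_eq (hg : IsKahler g) (hφ : φ ∈ holomorphicCharts n M) {z : Cn n}
    (hz : z ∈ φ.target) (a b : Fin n) : metricMatrix g φ z a b =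
    ((metricForm g φ z (e a) (e b) : ℂ) + Complex.I * metricForm g φ z (e a) (Complex.I • e b)) / 2
      := by
  simp only [metricMatrix, Matrix.of_apply, holPart, antiPart, ← metricForm_apply,
    metricForm_I_smul hg hφ hz, metricForm_I_smul_left hg hφ hz, Complex.ofReal_neg]
  ring_nf; simp only [Complex.I_sq]; ring

theorem hermitianForm_eq_sum (hg : IsKahler g) (hφ : φ ∈ holomorphicCharts n M) {z : Cn n}
    (hz : z ∈ φ.target) (u v : Cn n) : hermitianForm hg hφ hz u v =
    ∑ a, ∑ b, u a * metricMatrix g φ z a b * conj (v b) := by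
  have h : ∀ w : Cn n, w = ∑ a, w a • (e a : Cn n) := fun w => by
    conv_lhs => rw [pi_eq_sum_univ' w]
    rfl
  conv_lhs => rw [h u, h v]
  simp only [map_sum, LinearMap.sum_apply, map_smulₛₗ, LinearMap.smul_apply, smul_eq_mul,
    hermitianForm_apply, ← metricMatrix_eq hg hφ hz, RingHom.id_apply, Finset.mul_sum]
  rw [Finset.sum_comm]
  exact Finset.sum_congr rfl fun a _ => Finset.sum_congr rfl fun b _ => by ring

/-- The matrix determines the metric: `g` is twice the real part of its Hermitian form. The factor
is the origin of the `/ 2` in `quadraticPotential`. -/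
theorem metricForm_eq_re (hg : IsKahler g) (hφ : φ ∈ holomorphicCharts n M) {z : Cn n}
    (hz : z ∈ φ.target) (u v : Cn n) : metricForm g φ z u v =
    2 * (∑ a, ∑ b, u a * metricMatrix g φ z a b * conj (v b)).re := by
  rw [← hermitianForm_eq_sum hg hφ hz, hermitianForm_apply]
  simp only [Complex.div_ofNat_re, Complex.add_re, Complex.ofReal_re, Complex.re_mul_ofReal,
    Complex.I_re]
  ring

theorem metricMatrix_conjTranspose (hg : IsKahler g) (hφ : φ ∈ holomorphicCharts n M) {z : Cn n}
    (hz : z ∈ φ.target) : (metricMatrix g φ z)ᴴ = metricMatrix g φ z := by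
  ext a b
  rw [Matrix.conjTranspose_apply, metricMatrix_eq hg hφ hz, metricMatrix_eq hg hφ hz,
    metricForm_comm z (e b) (e a), metricForm_comm z (e b) (Complex.I • e a),
    metricForm_I_smul_left hg hφ hz]
  simp

theorem isUnit_metricMatrix (hg : IsKahler g) (hφ : φ ∈ holomorphicCharts n M) {z : Cn n}
    (hz : z ∈ φ.target) : IsUnit (metricMatrix g φ z) := by
  rw [← Matrix.mulVec_injective_iff_isUnit]
  intro x y hxy
  by_contra hne
  have h0 : metricMatrix g φ z *ᵥ (x - y) = 0 := by rw [Matrix.mulVec_sub]; simp [hxy]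
  set d := x - y with hd
  -- The form is antilinear in its second argument, so a kernel vector `d` has to be tested at its
  -- conjugate.
  have hs : (star d : Cn n) ≠ 0 := by simpa [hd, sub_eq_zero] using hne
  refine (metricForm_pos (g := g) hφ hz hs).ne' ?_
  rw [metricForm_eq_re hg hφ hz]
  have : ∑ a, ∑ b, (star d) a * metricMatrix g φ z a b * conj ((star d) b) =
      ∑ a, (star d) a * (metricMatrix g φ z *ᵥ d) a := by
    simp [Matrix.mulVec, dotProduct, Finset.mul_sum, mul_assoc]
  rw [this, h0]
  simp

theorem contDiffAt_metricMatrix (hg : IsKahler g) (hφ : φ ∈ holomorphicCharts n M) {z : Cn n}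
    (hz : z ∈ φ.target) (a b : Fin n) :
    ContDiffAt ℝ ∞ (fun y => metricMatrix g φ y a b) z := by
  have h1 := contDiffAt_metricForm (g := g) hφ hz (e a) (e b)
  have h2 := contDiffAt_metricForm (g := g) hφ hz (e a) (Complex.I • e b)
  have h : ContDiffAt ℝ ∞ (fun y => ((metricForm g φ y (e a) (e b) : ℂ) +
      Complex.I * metricForm g φ y (e a) (Complex.I • e b)) / 2) z :=
    ((Complex.ofRealCLM.contDiff.contDiffAt.comp z h1).add (contDiffAt_const.mul
      (Complex.ofRealCLM.contDiff.contDiffAt.comp z h2))).div_const 2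
  refine h.congr_of_eventuallyEq ?_
  filter_upwards [φ.open_target.mem_nhds hz] with y hy
  exact metricMatrix_eq hg hφ hy a b

theorem fderiv_metricMatrix (hg : IsKahler g) (hφ : φ ∈ holomorphicCharts n M) {z : Cn n}
    (hz : z ∈ φ.target) (a b : Fin n) (w : Cn n) :
    fderiv ℝ (fun y => metricMatrix g φ y a b) z w =
      ((fderiv ℝ (fun y => metricForm g φ y (e a) (e b)) z w : ℂ) +
        Complex.I * fderiv ℝ (fun y => metricForm g φ y (e a) (Complex.I • e b)) z w) / 2 := by
  have h1 := ((contDiffAt_metricForm (g := g) hφ hz (e a) (e b)).differentiableAt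
    (by simp)).hasFDerivAt
  have h2 := ((contDiffAt_metricForm (g := g) hφ hz (e a) (Complex.I • e b)).differentiableAt
    (by simp)).hasFDerivAt
  have h := ((Complex.ofRealCLM.hasFDerivAt.comp z h1).add
    ((Complex.ofRealCLM.hasFDerivAt.comp z h2).const_mul Complex.I)).mul_const (2⁻¹ : ℂ)
  have hE : (fun y => metricMatrix g φ y a b) =ᶠ[𝓝 z]
      fun y => ((metricForm g φ y (e a) (e b) : ℂ) +
        Complex.I * metricForm g φ y (e a) (Complex.I • e b)) * 2⁻¹ := by
    filter_upwards [φ.open_target.mem_nhds hz] with y hy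
    rw [metricMatrix_eq hg hφ hy a b, div_eq_mul_inv]
  rw [hE.fderiv_eq]
  erw [h.fderiv]
  simp [div_eq_mul_inv, mul_comm, mul_add]

/-- Closedness of the fundamental form eliminates the derivatives along `i e_p` from `4 ∂_p g_{q
b̄}`; what is left (`key`) is visibly symmetric in `p` and `q`. -/
theorem dz_metricMatrix_comm (hg : IsKahler g) (hφ : φ ∈ holomorphicCharts n M) {z : Cn n}
    (hz : z ∈ φ.target) (a b c : Fin n) :
    dz c (fun y => metricMatrix g φ y a b) z = dz a (fun y => metricMatrix g φ y c b) z := by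
  set D : Cn n → Cn n → Cn n → ℝ := fun w u v => fderiv ℝ (fun y => metricForm g φ y u v) z w
    with hD
  have hcongr : ∀ {f f' : Cn n → ℝ} (w : Cn n), (∀ y ∈ φ.target, f y = f' y) →
      fderiv ℝ f z w = fderiv ℝ f' z w := fun w h => by
    rw [Filter.EventuallyEq.fderiv_eq (Filter.eventuallyEq_of_mem (φ.open_target.mem_nhds hz) h)]
  have hsymm : ∀ w u v, D w u v = D w v u := fun w u v =>
    hcongr w fun y _ => metricForm_comm y u v
  have hI : ∀ w u v, D w (Complex.I • u) (Complex.I • v) = D w u v := fun w u v =>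
    hcongr w fun y hy => metricForm_I_smul hg hφ hy u v
  have hneg : ∀ w u v, D w u (-v) = - D w u v := fun w u v => by
    simp only [hD, map_neg, fderiv_fun_neg, neg_apply]
  have hIl : ∀ w u v, D w (Complex.I • u) v = - D w u (Complex.I • v) := fun w u v => by
    rw [← hI, smul_smul, Complex.I_mul_I, neg_one_smul, hsymm, hneg, hsymm]
  have hcl : ∀ u v w, D u v (Complex.I • w) - D v u (Complex.I • w) + D w u (Complex.I • v) = 0 :=
    fun u v w => by
      have h := hg.closed φ hφ z hz u v w
      rw [hcongr (f' := fun y => metricForm g φ y v (Complex.I • w)) u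
          fun y hy => fundamentalForm_eq hφ hy v w,
        hcongr (f' := fun y => metricForm g φ y u (Complex.I • w)) v
          fun y hy => fundamentalForm_eq hφ hy u w,
        hcongr (f' := fun y => metricForm g φ y u (Complex.I • v)) w
          fun y hy => fundamentalForm_eq hφ hy u v] at h
      exact h
  have hII : ∀ u : Cn n, Complex.I • Complex.I • u = -u := fun u => by
    rw [smul_smul, Complex.I_mul_I, neg_one_smul]
  have key : ∀ p q : Fin n, 4 * dz p (fun y => metricMatrix g φ y q b) z =
      ((D (e p) (e q) (e b) + D (e q) (e p) (e b) - D (e b) (e p) (e q) : ℝ) : ℂ) +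
      Complex.I * ((D (e p) (e q) (Complex.I • e b) + D (e q) (e p) (Complex.I • e b)
        - D (Complex.I • e b) (e p) (e q) : ℝ) : ℂ) := by
    intro p q
    have h1 : D (Complex.I • e p) (e q) (Complex.I • e b) =
        D (e q) (e p) (e b) - D (e b) (e p) (e q) := by
      have := hcl (Complex.I • e p) (e q) (e b)
      rw [hI, hI] at this
      linarith
    have h2 : D (Complex.I • e p) (e q) (e b) =
        - D (e q) (e p) (Complex.I • e b) + D (Complex.I • e b) (e p) (e q) := by
      have := hcl (Complex.I • e p) (e q) (Complex.I • e b)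
      rw [hII, hneg, hneg, hI, hIl] at this
      linarith
    rw [dz, holPart, fderiv_metricMatrix hg hφ hz, fderiv_metricMatrix hg hφ hz]
    change 4 * (((((D (e p) (e q) (e b) : ℝ) : ℂ) + Complex.I * (D (e p) (e q) (Complex.I • e b) : ℝ))
      / 2 - Complex.I * ((((D (Complex.I • e p) (e q) (e b) : ℝ) : ℂ) +
        Complex.I * (D (Complex.I • e p) (e q) (Complex.I • e b) : ℝ)) / 2)) / 2) = _
    rw [h1, h2]
    push_cast
    ring_nf; simp only [Complex.I_sq]; ring
  have h4 : (4 : ℂ) ≠ 0 := by norm_num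
  apply mul_left_cancel₀ h4
  rw [key, key, hsymm (e b) (e c), hsymm (Complex.I • e b) (e c)]
  congr 2 <;> ring_nf

theorem isFlatKahlerMatrix (hg : IsKahler g) (hR : HasVanishingCurvature g)
    (hφ : φ ∈ holomorphicCharts n M) : IsFlatKahlerMatrix (metricMatrix g φ) φ.target where
  isOpen := φ.open_target
  contDiffAt _ hz := contDiffAt_metricMatrix hg hφ hz
  hermitian _ hz := metricMatrix_conjTranspose hg hφ hz
  isUnit _ hz := isUnit_metricMatrix hg hφ hz
  curvature z hz a b c d := sub_eq_zero.1 (hR φ hφ z hz a b c d)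
  closed _ hz := dz_metricMatrix_comm hg hφ hz

end MetricForm
end KahlerFrobenius

end

/-! ### Flat charts and the affine atlas. -/

noncomputable section

open Set Metric Filter
open scoped Real Topology Manifold ContDiff Bundle ComplexConjugate Matrix

namespace KahlerFrobenius

section SmallSets

/-- Balls for half a Lebesgue entourage: if two of them share `q`, both lie in the full ball about
`q`, hence in one `U i`. -/
theorem exists_small_open_nhds {X ι : Type*} [TopologicalSpace X] [T2Space X] [CompactSpace X]
    {U : ι → Set X} (hU : ∀ i, IsOpen (U i)) (hc : ∀ x, ∃ i, x ∈ U i) :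
    ∃ N : X → Set X, (∀ x, IsOpen (N x)) ∧ (∀ x, x ∈ N x) ∧
      ∀ x y, (N x ∩ N y).Nonempty → ∃ i, N x ∪ N y ⊆ U i := by
  let _ := uniformSpaceOfCompactR1 (γ := X)
  obtain ⟨V, hV, hVU⟩ := lebesgue_number_lemma isCompact_univ hU
    (fun x _ => mem_iUnion.2 (hc x))
  obtain ⟨W, hW, hWo, hWs, hWV⟩ := comp_open_symm_mem_uniformity_sets hV
  refine ⟨fun x => UniformSpace.ball x W, fun x => UniformSpace.isOpen_ball x hWo,
    fun x => UniformSpace.mem_ball_self x hW, ?_⟩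
  rintro x y ⟨q, hqx, hqy⟩
  obtain ⟨i, hi⟩ := hVU q (mem_univ q)
  refine ⟨i, Subset.trans ?_ hi⟩
  have hsub : ∀ p, q ∈ UniformSpace.ball p W → UniformSpace.ball p W ⊆ UniformSpace.ball q V := by
    intro p hp r hr
    exact hWV ⟨p, UniformSpace.mem_ball_symmetry.1 hp, hr⟩
  exact union_subset (hsub x hqx) (hsub y hqy)

end SmallSets

theorem sum_congruence {ι : Type*} [Fintype ι] (u v : ι → ℂ) (P H : ι → ι → ℂ) :
    ∑ a, ∑ b, u a * (∑ i, ∑ j, P a i * H i j * conj (P b j)) * conj (v b) =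
      ∑ i, ∑ j, (∑ a, u a * P a i) * H i j * conj (∑ b, v b * P b j) := by
  calc _ = ∑ p : ι × ι, ∑ q : ι × ι,
        u p.1 * (P p.1 q.1 * H q.1 q.2 * conj (P p.2 q.2)) * conj (v p.2) := by
        simp only [Fintype.sum_prod_type, Finset.mul_sum, Finset.sum_mul]
    _ = ∑ q : ι × ι, ∑ p : ι × ι,
        u p.1 * (P p.1 q.1 * H q.1 q.2 * conj (P p.2 q.2)) * conj (v p.2) := Finset.sum_comm
    _ = _ := by
        simp only [Fintype.sum_prod_type, map_sum, map_mul]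
        refine Finset.sum_congr rfl fun i _ => Finset.sum_congr rfl fun j _ => ?_
        rw [Finset.sum_mul, Finset.sum_mul_sum]
        exact Finset.sum_congr rfl fun a _ => Finset.sum_congr rfl fun b _ => by ring

section FlatChart

variable {n : ℕ} {M : Type*} [TopologicalSpace M] [ChartedSpace (Cn n) M]
  [IsManifold 𝓘(ℂ, Cn n) ω M] {g : Metric n M} {φ ψ : OpenPartialHomeomorph M (Cn n)}

/-- A holomorphic chart in which the components of the metric are constant. -/
structure IsFlatChart (g : Metric n M) (φ : OpenPartialHomeomorph M (Cn n)) : Prop where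
  mem : φ ∈ holomorphicCharts n M
  metricForm_eq : ∀ z ∈ φ.target, ∀ z' ∈ φ.target, metricForm g φ z = metricForm g φ z'

theorem exists_isFlatChart (hg : IsKahler g) (hR : HasVanishingCurvature g) (p : M) :
    ∃ φ, IsFlatChart g φ ∧ p ∈ φ.source := by
  set χ := chartAt (Cn n) p with hχ
  -- A translation that puts `p` at the origin, where `exists_flat_coordinates` is based.
  set τ := (Homeomorph.addRight (-(χ p))).toOpenPartialHomeomorph with hτ
  have hτ1 : ContDiffOn ℂ ω τ τ.source :=
    (contDiff_id.add contDiff_const : ContDiff ℂ ω fun z : Cn n => z + -(χ p)).contDiffOn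
  have hτ2 : ContDiffOn ℂ ω τ.symm τ.target :=
    (contDiff_id.add contDiff_const : ContDiff ℂ ω fun z : Cn n => z + -(-(χ p))).contDiffOn
  set φ := χ.trans τ with hφdef
  have hφ : φ ∈ holomorphicCharts n M :=
    trans_mem_holomorphicCharts (chartAt_mem_holomorphicCharts p) hτ1 hτ2
  have hp : p ∈ φ.source := by simp [hφdef, hτ, hχ]
  have hp0 : φ p = 0 := by simp [hφdef, hτ]
  have h0 : (0 : Cn n) ∈ φ.target := hp0 ▸ φ.map_source hp
  obtain ⟨w, hw0, hwU, hw, hw', hG⟩ := (isFlatKahlerMatrix hg hR hφ).exists_flat_coordinates h0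
  have hψ := trans_mem_holomorphicCharts hφ hw hw'
  set ψ := φ.trans w with hψdef
  refine ⟨ψ, ⟨hψ, ?_⟩, by simp [hψdef, hp, hp0, hw0]⟩
  -- The differential of `w` carries the matrix of `g` at each point to its value at `0`, so the
  -- right side does not involve `z`.
  have key : ∀ z ∈ ψ.target, ∀ u v, metricForm g ψ z u v =
      2 * (∑ i, ∑ j, u i * metricMatrix g φ 0 i j * conj (v j)).re := by
    intro z hz u v
    have hzw : z ∈ w.target := hz.1
    have hy : w.symm z ∈ w.source := w.map_target hzw
    have hyφ : w.symm z ∈ φ.target := hwU hy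
    have hx : ψ.symm z ∈ ψ.source := ψ.map_target hz
    have hxφ : ψ.symm z ∈ φ.source := φ.map_target hyφ
    have hE : (ψ ∘ φ.symm) =ᶠ[𝓝 (w.symm z)] w := by
      filter_upwards [φ.open_target.mem_nhds hyφ] with y hy
      simp [hψdef, φ.right_inv hy]
    have hd : DifferentiableAt ℂ w (w.symm z) :=
      (hw.contDiffAt (w.open_source.mem_nhds hy)).differentiableAt (by simp)
    have hD : ∀ u, fderiv ℝ (ψ ∘ φ.symm) (w.symm z) u = fderiv ℂ w (w.symm z) u := by
      intro u
      rw [hE.fderiv_eq, hd.fderiv_restrictScalars ℝ]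
      rfl
    have hsurj : ∀ u, ∃ u', fderiv ℂ w (w.symm z) u' = u := by
      intro u
      refine ⟨chartDeriv φ (ψ.symm z) (coordField ψ u (ψ.symm z)), ?_⟩
      have h1 := chartDeriv_change hφ hψ hxφ hx (coordField ψ u (ψ.symm z))
      have h2 : φ (ψ.symm z) = w.symm z := φ.right_inv hyφ
      rw [chartDeriv_coordField hψ hx, h2, hD] at h1
      exact h1.symm
    obtain ⟨u', rfl⟩ := hsurj u
    obtain ⟨v', rfl⟩ := hsurj v
    have h3 := metricForm_change (g := g) hφ hψ hyφ hx u' v'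
    have h4 : ψ (φ.symm (w.symm z)) = z := ψ.right_inv hz
    rw [h4, hD, hD] at h3
    rw [← h3, metricForm_eq_re hg hφ hyφ]
    have hL : ∀ u i, fderiv ℂ w (w.symm z) u i = ∑ a, u a * fderiv ℂ w (w.symm z) (e a) i := by
      intro u i
      conv_lhs => rw [pi_eq_sum_univ' u]
      simp only [map_sum, map_smul, Finset.sum_apply, Pi.smul_apply, smul_eq_mul]
      rfl
    simp only [hG _ hy]
    refine congrArg (fun c : ℂ => 2 * c.re) ((sum_congruence u' v'
      (fun a i => fderiv ℂ w (w.symm z) (e a) i) (metricMatrix g φ 0)).trans ?_)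
    simp only [← hL]
  intro z hz z' hz'
  refine LinearMap.ext fun u => LinearMap.ext fun v => ?_
  rw [key z hz, key z' hz']

/-- Differentiating `B'(dF u, dF v) = B(u, v)` shows that `B'(d²F(w, u), dF v)` is antisymmetric in
`u, v`; it is also symmetric in `w, u`. Such a trilinear form is zero, as in the uniqueness of the
Levi-Civita connection. Then `d²F = 0` because `dF` is onto and `B'` is definite. -/
theorem fderiv_transition_eq_zero {F : Cn n → Cn n} {B B' : Cn n →ₗ[ℝ] Cn n →ₗ[ℝ] ℝ} {S : Set (Cn n)}
    (hS : IsOpen S) (hF : ∀ z ∈ S, ContDiffAt ℝ ω F z) (hsymm : ∀ u v, B' u v = B' v u)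
    (hpos : ∀ u, u ≠ 0 → 0 < B' u u)
    (hsurj : ∀ z ∈ S, Function.Surjective (fderiv ℝ F z))
    (h : ∀ z ∈ S, ∀ u v, B' (fderiv ℝ F z u) (fderiv ℝ F z v) = B u v) {z : Cn n} (hz : z ∈ S) :
    fderiv ℝ (fderiv ℝ F) z = 0 := by
  set L := fderiv ℝ F z with hL
  set L' := fderiv ℝ (fderiv ℝ F) z with hL'
  have hdL : HasFDerivAt (fderiv ℝ F) L' z :=
    (((hF z hz).fderiv_right (m := 1) (by simp)).differentiableAt (by simp)).hasFDerivAt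
  have hsecond : ∀ u v, L' u v = L' v u := fun u v =>
    ((hF z hz).isSymmSndFDerivAt (by simp)).eq u v
  let Bc : Cn n →L[ℝ] Cn n →L[ℝ] ℝ := LinearMap.toContinuousLinearMap
    ((LinearMap.toContinuousLinearMap : (Cn n →ₗ[ℝ] ℝ) ≃ₗ[ℝ] (Cn n →L[ℝ] ℝ)).toLinearMap ∘ₗ B')
  have hBc : ∀ u v, Bc u v = B' u v := fun _ _ => rfl
  have hdiff : ∀ w u v, B' (L' w u) (L v) + B' (L u) (L' w v) = 0 := by
    intro w u v
    have h1 := Bc.hasFDerivAt_of_bilinear (hdL.clm_apply (hasFDerivAt_const u z))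
      (hdL.clm_apply (hasFDerivAt_const v z))
    have h2 : (fun y => Bc (fderiv ℝ F y u) (fderiv ℝ F y v)) =ᶠ[𝓝 z] fun _ => B u v :=
      Filter.eventuallyEq_of_mem (hS.mem_nhds hz) fun y hy => h y hy u v
    have h3 := (h1.congr_of_eventuallyEq h2.symm).unique (hasFDerivAt_const (B u v) z)
    have h4 := congrArg (fun T => T w) h3
    simp [hBc] at h4
    rw [← hL] at h4
    linarith
  have hzero : ∀ w u v, B' (L' w u) (L v) = 0 := by
    intro w u v
    have h1 := hdiff w u v
    have h2 := hdiff u v w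
    have h3 := hdiff v w u
    rw [hsymm (L u)] at h1
    rw [hsymm (L v), hsecond u w] at h2
    rw [hsymm (L w), hsecond v u] at h3
    rw [hsecond w v] at h1
    linarith
  ext1 w
  ext1 u
  by_contra hne
  obtain ⟨v, hv⟩ := hsurj z hz (L' w u)
  refine (hpos (L' w u) hne).ne' ?_
  conv_lhs => rw [← hv]
  rw [hv]
  exact hv ▸ hzero w u v

/-- On a connected set the differential is a constant `A`, and then `F - A` is constant. Holomorphy
makes `A` complex linear. -/
theorem exists_affineEquiv_eqOn {F : Cn n → Cn n} {V : Set (Cn n)} (hV : IsOpen V)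
    (hVc : IsPreconnected V) (hF : ∀ z ∈ V, ContDiffAt ℂ ω F z)
    (hinj : ∀ z ∈ V, Function.Injective (fderiv ℂ F z))
    (h2 : ∀ z ∈ V, fderiv ℝ (fderiv ℝ F) z = 0) :
    ∃ L : Cn n ≃ᵃ[ℂ] Cn n, EqOn F L V := by
  rcases V.eq_empty_or_nonempty with rfl | ⟨z₀, hz₀⟩
  · exact ⟨AffineEquiv.refl ℂ (Cn n), eqOn_empty _ _⟩
  have hres : ∀ z ∈ V, fderiv ℝ F z = (fderiv ℂ F z).restrictScalars ℝ := fun z hz =>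
    ((hF z hz).differentiableAt (by simp)).fderiv_restrictScalars ℝ
  have hconst : ∀ z ∈ V, fderiv ℝ F z = fderiv ℝ F z₀ := by
    intro z hz
    refine hV.is_const_of_fderiv_eq_zero hVc (𝕜 := ℝ) (f := fderiv ℝ F) (fun y hy => ?_)
      (fun y hy => h2 y hy) hz hz₀
    exact ((((hF y hy).restrict_scalars ℝ).fderiv_right (m := 1) (by simp)).differentiableAt
      (by simp)).differentiableWithinAt
  set A := fderiv ℂ F z₀ with hA
  have hE : ∀ z ∈ V, F z - A z = F z₀ - A z₀ := by
    intro z hz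
    have hd : ∀ y ∈ V, HasFDerivAt (fun z => F z - A z) (0 : Cn n →L[ℝ] Cn n) y := by
      intro y hy
      have h3 := (((hF y hy).differentiableAt (by simp)).restrictScalars ℝ).hasFDerivAt.sub
        (A.restrictScalars ℝ).hasFDerivAt
      rw [hconst y hy, hres z₀ hz₀, sub_self] at h3
      exact h3
    exact hV.is_const_of_fderiv_eq_zero hVc (𝕜 := ℝ) (f := fun z => F z - A z)
      (fun y hy => (hd y hy).differentiableAt.differentiableWithinAt)
      (fun y hy => (hd y hy).fderiv) hz hz₀
  let A' : Cn n ≃ₗ[ℂ] Cn n := LinearEquiv.ofBijective A.toLinearMap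
    ⟨hinj z₀ hz₀, LinearMap.injective_iff_surjective.1 (hinj z₀ hz₀)⟩
  refine ⟨A'.toAffineEquiv.trans (AffineEquiv.constVAdd ℂ (Cn n) (F z₀ - A z₀)), fun z hz => ?_⟩
  change F z = (F z₀ - A z₀) + A z
  rw [← hE z hz, sub_add_cancel]

theorem fderiv_transition_bijective (hφ : φ ∈ holomorphicCharts n M)
    (hψ : ψ ∈ holomorphicCharts n M) {z : Cn n} (hz : z ∈ φ.target) (hz' : φ.symm z ∈ ψ.source) :
    Function.Bijective (fderiv ℝ (ψ ∘ φ.symm) z) := by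
  have hx := φ.map_target hz
  have h : ∀ u, fderiv ℝ (ψ ∘ φ.symm) z u = chartDeriv ψ (φ.symm z) (coordField φ u (φ.symm z)) :=
    fun u => by rw [chartDeriv_coordField_change hφ hψ hx hz', φ.right_inv hz]
  refine ⟨fun u v huv => ?_, fun u => ⟨chartDeriv φ (φ.symm z) (coordField ψ u (φ.symm z)), ?_⟩⟩
  · rw [h, h] at huv
    have := chartDeriv_injective hψ hz' huv
    rw [← chartDeriv_coordField hφ hx u, this, chartDeriv_coordField hφ hx]
  · rw [h, coordField_chartDeriv hφ hx, chartDeriv_coordField hψ hz']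

theorem IsFlatChart.exists_affineEquiv (hφ : IsFlatChart g φ) (hψ : IsFlatChart g ψ)
    {V : Set (Cn n)} (hV : IsOpen V) (hVc : IsPreconnected V) (hVφ : V ⊆ φ.target)
    (hVψ : ∀ z ∈ V, φ.symm z ∈ ψ.source) :
    ∃ L : Cn n ≃ᵃ[ℂ] Cn n, ∀ z ∈ V, ψ (φ.symm z) = L z := by
  have hF : ∀ z ∈ V, ContDiffAt ℂ ω (ψ ∘ φ.symm) z := fun z hz =>
    contDiffAt_transition hφ.mem hψ.mem (hVφ hz) (hVψ z hz)
  refine exists_affineEquiv_eqOn hV hVc hF (fun z hz => ?_) (fun z hz => ?_)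
  · have h := (fderiv_transition_bijective hφ.mem hψ.mem (hVφ hz) (hVψ z hz)).1
    rw [((hF z hz).differentiableAt (by simp)).fderiv_restrictScalars ℝ] at h
    exact h
  · have hx := ψ.map_source (hVψ z hz)
    refine fderiv_transition_eq_zero (B := metricForm g φ z)
      (B' := metricForm g ψ (ψ (φ.symm z))) hV (fun y hy => (hF y hy).restrict_scalars ℝ)
      (fun u v => metricForm_comm _ u v) (fun u hu => metricForm_pos hψ.mem hx hu)
      (fun y hy => (fderiv_transition_bijective hφ.mem hψ.mem (hVφ hy) (hVψ y hy)).2)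
      (fun y hy u v => ?_) hz
    rw [hφ.metricForm_eq z (hVφ hz) y (hVφ hy), metricForm_change hφ.mem hψ.mem (hVφ hy) (hVψ y hy),
      hψ.metricForm_eq _ hx _ (ψ.map_source (hVψ y hy))]

theorem IsFlatChart.restr (hφ : IsFlatChart g φ) {V : Set (Cn n)} (hV : IsOpen V) :
    IsFlatChart g (φ.trans (OpenPartialHomeomorph.ofSet V hV)) where
  mem := trans_mem_holomorphicCharts hφ.mem contDiffOn_id contDiffOn_id
  metricForm_eq z hz z' hz' := hφ.metricForm_eq z hz.2 z' hz'.2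

/-- A Kähler manifold with vanishing curvature which is compact has an atlas of flat charts with
affine coordinate changes. -/
theorem exists_flat_affineStructure [T2Space M] [CompactSpace M] (hg : IsKahler g)
    (hR : HasVanishingCurvature g) :
    ∃ 𝒜 : HolomorphicAffineStructure n M, ∀ φ ∈ 𝒜.charts, IsFlatChart g φ := by
  choose Ψ hΨ hmem using exists_isFlatChart hg hR
  obtain ⟨N, hNo, hN, hNU⟩ := exists_small_open_nhds (U := fun p => (Ψ p).source)
    (fun p => (Ψ p).open_source) (fun x => ⟨x, hmem x⟩)
  have hball : ∀ x, ∃ r > 0, ball (Ψ x x) r ⊆ (Ψ x).target ∩ (Ψ x).symm ⁻¹' N x := by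
    intro x
    refine Metric.isOpen_iff.1 ((Ψ x).isOpen_inter_preimage_symm (hNo x)) _
      ⟨(Ψ x).map_source (hmem x), ?_⟩
    rw [mem_preimage, (Ψ x).left_inv (hmem x)]
    exact hN x
  choose r hr hrN using hball
  -- The image of `Φ x` is a ball, hence connected, and its domain lies in the small set `N x`.
  let Φ : M → OpenPartialHomeomorph M (Cn n) := fun x =>
    (Ψ x).trans (OpenPartialHomeomorph.ofSet (ball (Ψ x x) (r x)) isOpen_ball)
  have hΦ : ∀ x, IsFlatChart g (Φ x) := fun x => (hΨ x).restr isOpen_ball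
  have hsrc : ∀ x, ∀ t ∈ (Φ x).source, t ∈ N x := by
    intro x t ht
    have h : (Ψ x).symm (Ψ x t) ∈ N x := (hrN x ht.2).2
    rwa [(Ψ x).left_inv ht.1] at h
  have htgt : ∀ x, (Φ x).target = ball (Ψ x x) (r x) := fun x =>
    Subset.antisymm (fun z hz => hz.1) fun z hz => ⟨hz, (hrN x hz).1⟩
  have haff : ∀ x p, N x ⊆ (Ψ p).source →
      ∃ L : Cn n ≃ᵃ[ℂ] Cn n, ∀ t ∈ (Φ x).source, Ψ p t = L (Φ x t) := by
    intro x p hxp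
    obtain ⟨L, hL⟩ := (hΦ x).exists_affineEquiv (hΨ p) (Φ x).open_target
      (by rw [htgt]; exact (convex_ball _ _).isPreconnected) subset_rfl
      (fun z hz => hxp (hsrc x _ ((Φ x).map_target hz)))
    refine ⟨L, fun t ht => ?_⟩
    rw [← hL _ ((Φ x).map_source ht), (Φ x).left_inv ht]
  refine ⟨⟨range Φ, ?_, ?_, ?_⟩, ?_⟩
  · rintro _ ⟨x, rfl⟩
    exact (hΦ x).mem
  · exact fun x => ⟨Φ x, mem_range_self x, hmem x, mem_ball_self (hr x)⟩
  · rintro _ ⟨x, rfl⟩ _ ⟨y, rfl⟩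
    by_cases hxy : ((Φ x).source ∩ (Φ y).source).Nonempty
    · obtain ⟨t, htx, hty⟩ := hxy
      -- Both charts are compared with the flat chart `Ψ p`, whose domain contains both of theirs.
      -- This gives one affine map on the overlap, connected or not.
      obtain ⟨p, hp⟩ := hNU x y ⟨t, hsrc x t htx, hsrc y t hty⟩
      obtain ⟨L, hL⟩ := haff x p (subset_union_left.trans hp)
      obtain ⟨L', hL'⟩ := haff y p (subset_union_right.trans hp)
      refine ⟨L.trans L'.symm, fun s hs => ?_⟩
      rw [AffineEquiv.trans_apply, ← hL s hs.1, hL' s hs.2, AffineEquiv.symm_apply_apply]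
    · exact ⟨AffineEquiv.refl ℂ (Cn n), fun s hs => (hxy ⟨s, hs⟩).elim⟩
  · rintro _ ⟨x, rfl⟩
    exact hΦ x

end FlatChart
end KahlerFrobenius

end

/-! ### Vector fields in coordinates and the coordinate derivative. -/

noncomputable section

open Set Metric Filter
open scoped Real Topology Manifold ContDiff Bundle ComplexConjugate Matrix

namespace KahlerFrobenius

set_option linter.unusedSectionVars false

section CoordinateFields

variable {n : ℕ} {M : Type*} [TopologicalSpace M] [ChartedSpace (Cn n) M]
  {φ ψ : OpenPartialHomeomorph M (Cn n)}

/-- The vector field `Y` in the coordinates `φ`. -/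
def fieldRep (φ : OpenPartialHomeomorph M (Cn n)) (Y : ∀ x : M, T n x) : Cn n → Cn n :=
  VectorField.mpullback 𝓘(ℝ, Cn n) 𝓘(ℝ, Cn n) φ.symm Y

theorem fieldRep_add (X Y : ∀ x : M, T n x) :
    fieldRep φ (X + Y) = fieldRep φ X + fieldRep φ Y :=
  VectorField.mpullback_add

theorem fieldRep_smul (f : M → ℝ) (Y : ∀ x : M, T n x) (z : Cn n) :
    fieldRep φ (f • Y) z = f (φ.symm z) • fieldRep φ Y z :=
  VectorField.mpullback_smul_apply

variable [IsManifold 𝓘(ℂ, Cn n) ω M]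

theorem isInvertible_mfderiv_symm (hφ : φ ∈ holomorphicCharts n M) {z : Cn n}
    (hz : z ∈ φ.target) :
    (mfderiv 𝓘(ℝ, Cn n) 𝓘(ℝ, Cn n) φ.symm z).IsInvertible :=
  ⟨(mdifferentiable_chart_real hφ).symm.mfderiv hz, rfl⟩

theorem fieldRep_eq (hφ : φ ∈ holomorphicCharts n M) (Y : ∀ x : M, T n x) {z : Cn n}
    (hz : z ∈ φ.target) : fieldRep φ Y z = chartDeriv φ (φ.symm z) (Y (φ.symm z)) := by
  have h1 := (mdifferentiable_chart_real hφ).symm_comp_deriv (φ.map_target hz)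
  rw [φ.right_inv hz] at h1
  have h2 := congrArg (fun L => L (Y (φ.symm z))) h1
  change (mfderiv 𝓘(ℝ, Cn n) 𝓘(ℝ, Cn n) φ.symm z).inverse (Y (φ.symm z)) = _
  conv_lhs => rw [← show _ = Y (φ.symm z) from h2]
  exact (isInvertible_mfderiv_symm hφ hz).inverse_apply_self _

theorem fieldRep_apply_chart (hφ : φ ∈ holomorphicCharts n M) (Y : ∀ x : M, T n x) {x : M}
    (hx : x ∈ φ.source) : fieldRep φ Y (φ x) = chartDeriv φ x (Y x) := by
  rw [fieldRep_eq hφ Y (φ.map_source hx), φ.left_inv hx]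

theorem coordField_fieldRep (hφ : φ ∈ holomorphicCharts n M) (Y : ∀ x : M, T n x) {x : M}
    (hx : x ∈ φ.source) : coordField φ (fieldRep φ Y (φ x)) x = Y x := by
  rw [fieldRep_apply_chart hφ Y hx, coordField_chartDeriv hφ hx]

/-- The vector field with given expression in the coordinates `φ`. -/
def fieldOfRep (φ : OpenPartialHomeomorph M (Cn n)) (Z : Cn n → Cn n) (x : M) : T n x :=
  VectorField.mpullback 𝓘(ℝ, Cn n) 𝓘(ℝ, Cn n) φ Z x

theorem contMDiffAt_fieldOfRep (hφ : φ ∈ holomorphicCharts n M) {Z : Cn n → Cn n} {x : M}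
    (hx : x ∈ φ.source) (hZ : ContDiffAt ℝ ∞ Z (φ x)) :
    ContMDiffAt 𝓘(ℝ, Cn n) (𝓘(ℝ, Cn n).prod 𝓘(ℝ, Cn n)) ∞
      (fun y => (⟨y, fieldOfRep φ Z y⟩ : TangentBundle 𝓘(ℝ, Cn n) M)) x := by
  refine ContMDiffAt.mpullback_vectorField_preimage (n := ω) ?_ (contMDiffAt_chart_real hφ hx)
    (isInvertible_chartDeriv hφ hx) (by simp)
  exact contMDiffAt_vectorSpace_iff_contDiffAt.2 hZ

theorem contDiffAt_fieldRep (hφ : φ ∈ holomorphicCharts n M) {Y : ∀ x : M, T n x} {x : M}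
    (hx : x ∈ φ.source) (hY : ContMDiffAt 𝓘(ℝ, Cn n) (𝓘(ℝ, Cn n).prod 𝓘(ℝ, Cn n)) ∞
      (fun y => (⟨y, Y y⟩ : TangentBundle 𝓘(ℝ, Cn n) M)) x) :
    ContDiffAt ℝ ∞ (fieldRep φ Y) (φ x) := by
  refine contMDiffAt_vectorSpace_iff_contDiffAt.1
    (ContMDiffAt.mpullback_vectorField_preimage (n := ω) ?_
      (contMDiffAt_chart_symm_real hφ (φ.map_source hx))
      (isInvertible_mfderiv_symm hφ (φ.map_source hx)) (by simp))
  rwa [φ.left_inv hx]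

theorem differentiableAt_fieldRep (hφ : φ ∈ holomorphicCharts n M) {Y : ∀ x : M, T n x} {x : M}
    (hx : x ∈ φ.source) (hY : DiffFieldAt Y x) : DifferentiableAt ℝ (fieldRep φ Y) (φ x) := by
  have h : MDifferentiableAt 𝓘(ℝ, Cn n) (𝓘(ℝ, Cn n).prod 𝓘(ℝ, Cn n))
      (fun z => (⟨z, fieldRep φ Y z⟩ : TangentBundle 𝓘(ℝ, Cn n) (Cn n))) (φ x) := by
    refine MDifferentiableAt.mpullback_vectorField (n := ω) ?_
      (contMDiffAt_chart_symm_real hφ (φ.map_source hx))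
      (isInvertible_mfderiv_symm hφ (φ.map_source hx)) (by simp)
    rw [φ.left_inv hx]
    exact hY
  have h2 := ((contMDiff_snd_tangentBundle_modelSpace (Cn n) 𝓘(ℝ, Cn n) (n := 1)).contMDiffAt
    |>.mdifferentiableAt (by simp)).comp (φ x) h
  exact mdifferentiableAt_iff_differentiableAt.1 h2

theorem fieldRep_mlieBracket (hφ : φ ∈ holomorphicCharts n M) {X Y : ∀ x : M, T n x} {x : M}
    (hx : x ∈ φ.source) (hX : DiffFieldAt X x) (hY : DiffFieldAt Y x) :
    chartDeriv φ x (VectorField.mlieBracket 𝓘(ℝ, Cn n) X Y x) =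
      fderiv ℝ (fieldRep φ Y) (φ x) (fieldRep φ X (φ x))
        - fderiv ℝ (fieldRep φ X) (φ x) (fieldRep φ Y (φ x)) := by
  rw [← fieldRep_apply_chart hφ _ hx]
  have h := VectorField.mpullback_mlieBracket (n := ω) (V := X) (W := Y) (f := φ.symm)
    (x₀ := φ x) (by rw [φ.left_inv hx]; exact hX) (by rw [φ.left_inv hx]; exact hY)
    (contMDiffAt_chart_symm_real hφ (φ.map_source hx)) (by simp)
  refine h.trans ?_
  rw [← VectorField.mlieBracketWithin_univ, VectorField.mlieBracketWithin_eq_lieBracketWithin]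
  exact congrFun (VectorField.lieBracketWithin_univ (𝕜 := ℝ) (V := fieldRep φ X)
    (W := fieldRep φ Y)) (φ x)

/-- The derivative of a vector field in the direction `V`, computed in the coordinates `φ`. -/
def chartConnection (φ : OpenPartialHomeomorph M (Cn n)) (Y : ∀ x : M, T n x) (x : M) :
    T n x →L[ℝ] T n x :=
  (chartDeriv φ x).inverse ∘L fderiv ℝ (fieldRep φ Y) (φ x) ∘L chartDeriv φ x

theorem chartConnection_apply (Y : ∀ x : M, T n x) (x : M) (V : T n x) :
    chartConnection φ Y x V = coordField φ (fderiv ℝ (fieldRep φ Y) (φ x) (chartDeriv φ x V)) x :=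
  rfl

theorem chartDeriv_chartConnection (hφ : φ ∈ holomorphicCharts n M) (Y : ∀ x : M, T n x) {x : M}
    (hx : x ∈ φ.source) (V : T n x) : chartDeriv φ x (chartConnection φ Y x V) =
      fderiv ℝ (fieldRep φ Y) (φ x) (chartDeriv φ x V) := by
  rw [chartConnection_apply, chartDeriv_coordField hφ hx]

/-- An affine change of coordinates has constant differential `A`, so the components of `Y` are only
multiplied by `A` and no second derivative of the transition map enters. -/
theorem chartConnection_eq_of_affine (hφ : φ ∈ holomorphicCharts n M)
    (hψ : ψ ∈ holomorphicCharts n M) {L : Cn n ≃ᵃ[ℂ] Cn n}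
    (hL : ∀ x ∈ φ.source ∩ ψ.source, ψ x = L (φ x)) {Y : ∀ x : M, T n x} {x : M}
    (hx : x ∈ φ.source) (hx' : x ∈ ψ.source) (hY : DiffFieldAt Y x) :
    chartConnection φ Y x = chartConnection ψ Y x := by
  let A : Cn n →L[ℝ] Cn n := (LinearMap.toContinuousLinearMap L.linear.toLinearMap).restrictScalars ℝ
  have hLd : ∀ z, HasFDerivAt L A z := by
    intro z
    have h1 : (L : Cn n → Cn n) = fun z => A z + L 0 := by
      funext z
      have := L.map_vadd 0 z
      change L z = L.linear z + L 0
      simpa using this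
    rw [h1]
    exact A.hasFDerivAt.add_const _
  have hW : ∀ y ∈ φ.source ∩ ψ.source, ∀ V : T n y, chartDeriv ψ y V = A (chartDeriv φ y V) := by
    intro y hy V
    rw [chartDeriv_change hφ hψ hy.1 hy.2]
    have hE : ψ ∘ φ.symm =ᶠ[𝓝 (φ y)] L := by
      filter_upwards [(φ.symm.trans ψ).open_source.mem_nhds
        (show φ y ∈ _ by simp [hy.1, hy.2])] with z hz
      have hz' : z ∈ φ.target ∧ φ.symm z ∈ ψ.source := by simpa using hz
      simpa [φ.right_inv hz'.1] using hL (φ.symm z) ⟨φ.map_target hz'.1, hz'.2⟩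
    rw [hE.fderiv_eq, (hLd _).fderiv]
  have hrep : (fieldRep ψ Y ∘ L) =ᶠ[𝓝 (φ x)] A ∘ fieldRep φ Y := by
    filter_upwards [(φ.symm.trans ψ).open_source.mem_nhds
        (show φ x ∈ _ by simp [hx, hx'])] with z hz
    have hz' : z ∈ φ.target ∧ φ.symm z ∈ ψ.source := by simpa using hz
    have h1 := hL (φ.symm z) ⟨φ.map_target hz'.1, hz'.2⟩
    rw [φ.right_inv hz'.1] at h1
    rw [Function.comp_apply, Function.comp_apply, ← h1, fieldRep_apply_chart hψ Y hz'.2,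
      hW _ ⟨φ.map_target hz'.1, hz'.2⟩, fieldRep_eq hφ Y hz'.1]
  have hLx : L (φ x) = ψ x := (hL x ⟨hx, hx'⟩).symm
  have hder : (fderiv ℝ (fieldRep ψ Y) (ψ x)).comp A = A.comp (fderiv ℝ (fieldRep φ Y) (φ x)) := by
    have hd := differentiableAt_fieldRep hψ hx' hY
    rw [← hLx] at hd
    have h1 := hd.hasFDerivAt.comp (φ x) (hLd (φ x))
    have h2 := A.hasFDerivAt.comp (φ x) (differentiableAt_fieldRep hφ hx hY).hasFDerivAt
    rw [hLx] at h1
    exact h1.unique (h2.congr_of_eventuallyEq hrep)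
  ext1 V
  apply chartDeriv_injective hψ hx'
  rw [chartDeriv_chartConnection hψ Y hx', hW x ⟨hx, hx'⟩, hW x ⟨hx, hx'⟩,
    chartDeriv_chartConnection hφ Y hx]
  exact (congrArg (fun T => T (chartDeriv φ x V)) hder).symm

theorem chartConnection_add (hφ : φ ∈ holomorphicCharts n M) {X Y : ∀ x : M, T n x} {x : M}
    (hx : x ∈ φ.source) (hX : DiffFieldAt X x) (hY : DiffFieldAt Y x) :
    chartConnection φ (X + Y) x = chartConnection φ X x + chartConnection φ Y x := by
  ext1 V
  apply chartDeriv_injective hφ hx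
  rw [add_apply, map_add, chartDeriv_chartConnection hφ _ hx, chartDeriv_chartConnection hφ _ hx,
    chartDeriv_chartConnection hφ _ hx, fieldRep_add, fderiv_add (differentiableAt_fieldRep hφ hx hX)
    (differentiableAt_fieldRep hφ hx hY), add_apply]

theorem chartConnection_smul (hφ : φ ∈ holomorphicCharts n M) {Y : ∀ x : M, T n x} {f : M → ℝ}
    {x : M} (hx : x ∈ φ.source) (hY : DiffFieldAt Y x)
    (hf : MDifferentiableAt 𝓘(ℝ, Cn n) 𝓘(ℝ) f x) :
    chartConnection φ (f • Y) x = f x • chartConnection φ Y x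
      + (mvfderiv 𝓘(ℝ, Cn n) f x).smulRight (Y x) := by
  have hfd : DifferentiableAt ℝ (f ∘ φ.symm) (φ x) := by
    refine mdifferentiableAt_iff_differentiableAt.1 (MDifferentiableAt.comp (φ x) ?_
      ((contMDiffAt_chart_symm_real hφ (φ.map_source hx)).mdifferentiableAt (by simp)))
    rwa [φ.left_inv hx]
  have hd : ∀ V, mvfderiv 𝓘(ℝ, Cn n) f x V = fderiv ℝ (f ∘ φ.symm) (φ x) (chartDeriv φ x V) := by
    intro V
    rw [← mvfderiv_comp_chart hφ hx hfd]
    have hE : f =ᶠ[𝓝 x] (f ∘ φ.symm) ∘ φ := by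
      filter_upwards [φ.open_source.mem_nhds hx] with y hy
      simp [φ.left_inv hy]
    rw [mvfderiv, mvfderiv, hE.mfderiv_eq]
    rfl
  ext1 V
  apply chartDeriv_injective hφ hx
  rw [add_apply, smul_apply, map_add, map_smul, chartDeriv_chartConnection hφ _ hx,
    chartDeriv_chartConnection hφ _ hx, ContinuousLinearMap.smulRight_apply, map_smul, hd,
    ← fieldRep_apply_chart hφ Y hx]
  have h1 : fieldRep φ (f • Y) = fun z => (f ∘ φ.symm) z • fieldRep φ Y z :=
    funext fun z => fieldRep_smul f Y z
  rw [h1, fderiv_fun_smul hfd (differentiableAt_fieldRep hφ hx hY)]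
  simp
  rw [φ.left_inv hx]

end CoordinateFields
end KahlerFrobenius

end

/-! ### The connection of an affine structure: smooth, flat, torsionless, metric. -/

noncomputable section

open Set Metric Filter
open scoped Real Topology Manifold ContDiff Bundle ComplexConjugate Matrix

namespace KahlerFrobenius

set_option linter.unusedSectionVars false

section AffineConnection

variable {n : ℕ} {M : Type*} [TopologicalSpace M] [ChartedSpace (Cn n) M]
  [IsManifold 𝓘(ℂ, Cn n) ω M] {g : Metric n M} {φ : OpenPartialHomeomorph M (Cn n)}

/-- The vector field `X` is smooth at `x`. -/
def SmoothFieldAt (X : ∀ x : M, T n x) (x : M) : Prop :=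
  ContMDiffAt 𝓘(ℝ, Cn n) (𝓘(ℝ, Cn n).prod 𝓘(ℝ, Cn n)) ∞
    (fun y => (⟨y, X y⟩ : TangentBundle 𝓘(ℝ, Cn n) M)) x

theorem SmoothFieldAt.diffFieldAt {X : ∀ x : M, T n x} {x : M} (h : SmoothFieldAt X x) :
    DiffFieldAt X x :=
  ContMDiffAt.mdifferentiableAt h (by simp)

theorem SmoothFieldAt.eventually {X : ∀ x : M, T n x} {x : M} (h : SmoothFieldAt X x) :
    ∀ᶠ y in 𝓝 x, DiffFieldAt X y := by
  have h1 : ContMDiffAt 𝓘(ℝ, Cn n) (𝓘(ℝ, Cn n).prod 𝓘(ℝ, Cn n)) 1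
    (fun y => (⟨y, X y⟩ : TangentBundle 𝓘(ℝ, Cn n) M)) x := ContMDiffAt.of_le h (by simp)
  filter_upwards [(contMDiffAt_iff_contMDiffAt_nhds (by simp)).1 h1] with y hy
  exact hy.mdifferentiableAt (by simp)

namespace HolomorphicAffineStructure

variable (𝒜 : HolomorphicAffineStructure n M)

/-- The connection of an affine structure. -/
def connection : Connection n M where
  toFun Y x := chartConnection (𝒜.cover x).choose Y x
  isCovariantDerivativeOnUniv :=
    { add := fun {_ _ x} hX hY _ => chartConnection_add
        (𝒜.holomorphic (𝒜.cover x).choose_spec.1) (𝒜.cover x).choose_spec.2 hX hY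
      leibniz := fun {_ _ x} hY hf _ => chartConnection_smul
        (𝒜.holomorphic (𝒜.cover x).choose_spec.1) (𝒜.cover x).choose_spec.2 hY hf }

variable {𝒜}

/-- Frees the connection from the arbitrary chart chosen at each point. -/
theorem connection_eq (hφ : φ ∈ 𝒜.charts) {Y : ∀ x : M, T n x} {x : M} (hx : x ∈ φ.source)
    (hY : DiffFieldAt Y x) : 𝒜.connection Y x = chartConnection φ Y x := by
  have hψ := (𝒜.cover x).choose_spec
  obtain ⟨L, hL⟩ := 𝒜.affine_change _ hψ.1 φ hφ
  exact chartConnection_eq_of_affine (𝒜.holomorphic hψ.1) (𝒜.holomorphic hφ) hL hψ.2 hx hY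

theorem chartDeriv_connection (hφ : φ ∈ 𝒜.charts) {Y : ∀ x : M, T n x} {x : M} (hx : x ∈ φ.source)
    (hY : DiffFieldAt Y x) (V : T n x) : chartDeriv φ x (𝒜.connection Y x V) =
      fderiv ℝ (fieldRep φ Y) (φ x) (chartDeriv φ x V) := by
  rw [connection_eq hφ hx hY, chartDeriv_chartConnection (𝒜.holomorphic hφ) Y hx]

/-- Smoothness at `x` ensures differentiability at nearby points, where `chartDeriv_connection` is
applied as well. -/
theorem fieldRep_connection (hφ : φ ∈ 𝒜.charts) {X Y : ∀ x : M, T n x} {x : M}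
    (hx : x ∈ φ.source) (hY : SmoothFieldAt Y x) :
    fieldRep φ (fun y => 𝒜.connection Y y (X y)) =ᶠ[𝓝 (φ x)]
      fun z => fderiv ℝ (fieldRep φ Y) z (fieldRep φ X z) := by
  have h := hY.eventually
  rw [← φ.left_inv hx] at h
  filter_upwards [(φ.continuousAt_symm (φ.map_source hx)).eventually h,
    φ.open_target.mem_nhds (φ.map_source hx)] with z hz hzt
  rw [fieldRep_eq (𝒜.holomorphic hφ) _ hzt, chartDeriv_connection hφ (φ.map_target hzt) hz,
    φ.right_inv hzt, fieldRep_eq (𝒜.holomorphic hφ) _ hzt]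

theorem eventuallyEq_fieldOfRep (hφ : φ ∈ holomorphicCharts n M) (Y : ∀ x : M, T n x) {x : M}
    (hx : x ∈ φ.source) : ∀ᶠ y in 𝓝 x, fieldOfRep φ (fieldRep φ Y) y = Y y := by
  filter_upwards [φ.open_source.mem_nhds hx] with y hy
  exact coordField_fieldRep hφ Y hy

theorem smoothFieldAt_of_fieldRep (hφ : φ ∈ holomorphicCharts n M) {Y : ∀ x : M, T n x} {x : M}
    (hx : x ∈ φ.source) (hY : ContDiffAt ℝ ∞ (fieldRep φ Y) (φ x)) : SmoothFieldAt Y x := by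
  refine (contMDiffAt_fieldOfRep hφ hx hY).congr_of_eventuallyEq ?_
  filter_upwards [eventuallyEq_fieldOfRep hφ Y hx] with y hy
  rw [hy]

theorem smoothFieldAt_connection {X Y : ∀ x : M, T n x} {x : M} (hX : SmoothFieldAt X x)
    (hY : SmoothFieldAt Y x) : SmoothFieldAt (fun y => 𝒜.connection Y y (X y)) x := by
  obtain ⟨φ, hφ, hx⟩ := 𝒜.cover x
  have hφ' := 𝒜.holomorphic hφ
  refine smoothFieldAt_of_fieldRep hφ' hx ?_
  refine ContDiffAt.congr_of_eventuallyEq ?_ (fieldRep_connection hφ hx hY)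
  exact ((contDiffAt_fieldRep hφ' hx hY).fderiv_right (m := ∞) (by simp)).clm_apply
    (contDiffAt_fieldRep hφ' hx hX)

theorem smooth_connection : CovariantDerivative.ContMDiffCovariantDerivative 𝒜.connection ∞ where
  contMDiff := by
    refine ⟨fun {Y} hY x _ => ContMDiffAt.contMDiffWithinAt ?_⟩
    have hY' : SmoothFieldAt Y x :=
      ((hY x (mem_univ x)).contMDiffAt univ_mem).of_le (by simp)
    rw [contMDiffAt_hom_bundle]
    refine ⟨contMDiffAt_id, ?_⟩
    set t := trivializationAt (Cn n) (TangentSpace 𝓘(ℝ, Cn n) (M := M)) x with ht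
    have hxt : x ∈ t.baseSet := FiberBundle.mem_baseSet_trivializationAt' x
    set b := Module.finBasis ℝ (Cn n) with hb
    have hframe : ∀ i, SmoothFieldAt (t.localFrame b i) x := fun i =>
      contMDiffAt_localFrame_of_mem ∞ t b i hxt
    have happ : ∀ i, ContMDiffAt 𝓘(ℝ, Cn n) 𝓘(ℝ, Cn n) ∞
        (fun y => (t ⟨y, 𝒜.connection Y y (t.localFrame b i y)⟩).2) x := fun i =>
      (Bundle.contMDiffAt_section x).1 (smoothFieldAt_connection (𝒜 := 𝒜) (hframe i) hY')
    -- A linear map is `∑ bⁱ ⊗ T(b_i)`, so smoothness of `∇Y` follows from that of `∇Y` applied to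
    -- each member of a local frame.
    have hsum : ContMDiffAt 𝓘(ℝ, Cn n) 𝓘(ℝ, Cn n →L[ℝ] Cn n) ∞ (fun y => ∑ i,
        ContinuousLinearMap.smulRightL ℝ (Cn n) (Cn n) (LinearMap.toContinuousLinearMap (b.coord i))
          (t ⟨y, 𝒜.connection Y y (t.localFrame b i y)⟩).2) x :=
      contMDiffAt_finsetSum fun i _ => (ContinuousLinearMap.contMDiff _).contMDiffAt.comp x (happ i)
    refine hsum.congr_of_eventuallyEq ?_
    filter_upwards [t.open_baseSet.mem_nhds hxt] with y hy
    rw [ContinuousLinearMap.inCoordinates_eq hy hy]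
    ext1 v
    have hfr : ∀ i, t.localFrame b i y = (t.continuousLinearEquivAt ℝ y hy).symm (b i) := fun i => by
      simp [hy, Bundle.Trivialization.basisAt]
    conv_lhs => rw [← b.sum_repr v, map_sum]
    simp only [sum_apply, map_smul, hfr]
    rfl

theorem isFlatConnection : IsFlatConnection 𝒜.connection := by
  intro U X Y Z hU hX hY hZ x hxU
  obtain ⟨φ, hφ, hx⟩ := 𝒜.cover x
  have hφ' := 𝒜.holomorphic hφ
  have hX' : SmoothFieldAt X x := hX.contMDiffAt (hU.mem_nhds hxU)
  have hY' : SmoothFieldAt Y x := hY.contMDiffAt (hU.mem_nhds hxU)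
  have hZ' : SmoothFieldAt Z x := hZ.contMDiffAt (hU.mem_nhds hxU)
  have hZc := contDiffAt_fieldRep hφ' hx hZ'
  have hdZ : DifferentiableAt ℝ (fderiv ℝ (fieldRep φ Z)) (φ x) :=
    (hZc.fderiv_right (m := ∞) (by simp)).differentiableAt (by simp)
  have hsym := hZc.isSymmSndFDerivAt
    (by rw [minSmoothness_of_isRCLikeNormedField]; exact WithTop.coe_le_coe.2 le_top)
  -- In coordinates `∇_W ∇_V Z = D²Z(W, V) + DZ(D_W V)`. Under antisymmetrization the first term
  -- drops out and the second is the derivative along the Lie bracket.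
  have key : ∀ {V W : ∀ x : M, T n x}, SmoothFieldAt V x → SmoothFieldAt W x →
      chartDeriv φ x (𝒜.connection (fun y => 𝒜.connection Z y (V y)) x (W x)) =
        fderiv ℝ (fderiv ℝ (fieldRep φ Z)) (φ x) (fieldRep φ W (φ x)) (fieldRep φ V (φ x)) +
          fderiv ℝ (fieldRep φ Z) (φ x)
            (fderiv ℝ (fieldRep φ V) (φ x) (fieldRep φ W (φ x))) := by
    intro V W hV hW
    rw [chartDeriv_connection hφ hx (smoothFieldAt_connection hV hZ').diffFieldAt,
      (fieldRep_connection hφ hx hZ').fderiv_eq,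
      fderiv_clm_apply hdZ ((contDiffAt_fieldRep hφ' hx hV).differentiableAt (by simp)),
      ← fieldRep_apply_chart hφ' W hx]
    simp [add_comm]
  apply chartDeriv_injective hφ' hx
  rw [map_sub, map_sub, key hY' hX', key hX' hY', chartDeriv_connection hφ hx hZ'.diffFieldAt,
    fieldRep_mlieBracket hφ' hx hX'.diffFieldAt hY'.diffFieldAt, map_sub,
    hsym.eq (fieldRep φ X (φ x)), map_zero]
  abel

theorem torsion_connection : 𝒜.connection.torsion = 0 := by
  rw [CovariantDerivative.torsion_eq_zero_iff]
  intro X Y x hX hY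
  obtain ⟨φ, hφ, hx⟩ := 𝒜.cover x
  have hφ' := 𝒜.holomorphic hφ
  apply chartDeriv_injective hφ' hx
  rw [map_sub, chartDeriv_connection hφ hx hY, chartDeriv_connection hφ hx hX,
    fieldRep_mlieBracket hφ' hx hX hY, fieldRep_apply_chart hφ' X hx, fieldRep_apply_chart hφ' Y hx]

theorem isFlatFieldOn_coordField (hφ : φ ∈ 𝒜.charts) (v : Cn n) :
    IsFlatFieldOn 𝒜.connection (coordField φ v) φ.source := by
  intro x hx
  have hφ' := 𝒜.holomorphic hφ
  have hd : DiffFieldAt (coordField φ v) x :=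
    (contMDiffAt_coordField hφ' hx v).mdifferentiableAt (by simp)
  refine ⟨hd, ?_⟩
  have hE : fieldRep φ (coordField φ v) =ᶠ[𝓝 (φ x)] fun _ => v := by
    filter_upwards [φ.open_target.mem_nhds (φ.map_source hx)] with z hz
    rw [fieldRep_eq hφ' _ hz, chartDeriv_coordField hφ' (φ.map_target hz)]
  ext1 V
  apply chartDeriv_injective hφ' hx
  rw [chartDeriv_connection hφ hx hd, hE.fderiv_eq]
  simp

/-- In a flat chart `g` is one fixed bilinear form, so compatibility is the product rule. -/
theorem isCompatible_connection (h : ∀ φ ∈ 𝒜.charts, IsFlatChart g φ) :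
    IsCompatible g 𝒜.connection := by
  intro x V X Y hX hY
  obtain ⟨φ, hφ, hx⟩ := 𝒜.cover x
  have hφ' := 𝒜.holomorphic hφ
  set B := (metricForm g φ (φ x)).toContinuousBilinearMap with hB
  have hXd := differentiableAt_fieldRep hφ' hx hX
  have hYd := differentiableAt_fieldRep hφ' hx hY
  have hE : (fun y => g.inner y (X y) (Y y)) =ᶠ[𝓝 x]
      (fun z => B (fieldRep φ X z) (fieldRep φ Y z)) ∘ φ := by
    filter_upwards [φ.open_source.mem_nhds hx] with y hy
    rw [Function.comp_apply, fieldRep_apply_chart hφ' X hy, fieldRep_apply_chart hφ' Y hy,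
      inner_eq_metricForm hφ' hy, (h φ hφ).metricForm_eq _ (φ.map_source hy) _ (φ.map_source hx)]
    rfl
  have hd := B.hasFDerivAt_of_bilinear hXd.hasFDerivAt hYd.hasFDerivAt
  have h1 : mvfderiv 𝓘(ℝ, Cn n) (fun y => g.inner y (X y) (Y y)) x V =
      fderiv ℝ (fun z => B (fieldRep φ X z) (fieldRep φ Y z)) (φ x) (chartDeriv φ x V) := by
    rw [← mvfderiv_comp_chart hφ' hx hd.differentiableAt, mvfderiv, mvfderiv, hE.mfderiv_eq]
    rfl
  rw [h1, hd.fderiv, inner_eq_metricForm hφ' hx, inner_eq_metricForm hφ' hx,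
    chartDeriv_connection hφ hx hX, chartDeriv_connection hφ hx hY,
    ← fieldRep_apply_chart hφ' X hx, ← fieldRep_apply_chart hφ' Y hx]
  simp [hB, add_comm]

end HolomorphicAffineStructure
end AffineConnection
end KahlerFrobenius

end

/-! ### Potentials in flat coordinates. -/

noncomputable section

open Set Metric Filter
open scoped Real Topology Manifold ContDiff Bundle ComplexConjugate Matrix

namespace KahlerFrobenius

set_option linter.unusedSectionVars false

section Potential

variable {n : ℕ}

/-- `∂_b̄` sees only the conjugated factor and `∂_a` only the holomorphic one. -/
theorem dz_dzbar_hermitian_sum {w : Cn n → Cn n} {S : Set (Cn n)} (hS : IsOpen S)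
    (hw : ∀ z ∈ S, ContDiffAt ℂ ω w z) (H : Fin n → Fin n → ℂ) {z : Cn n} (hz : z ∈ S)
    (a b : Fin n) :
    dz a (dzbar b fun y => ∑ i, ∑ j, w y i * H i j * conj (w y j)) z =
      ∑ i, ∑ j, fderiv ℂ w z (e a) i * H i j * conj (fderiv ℂ w z (e b) j) := by
  have hd : ∀ y ∈ S, ∀ i, DifferentiableAt ℂ (fun y => w y i) y := fun y hy i =>
    differentiableAt_pi.1 ((hw y hy).differentiableAt (by simp)) i
  have hdr : ∀ y ∈ S, ∀ i, DifferentiableAt ℝ (fun y => w y i) y := fun y hy i =>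
    (hd y hy i).restrictScalars ℝ
  have hdc : ∀ y ∈ S, ∀ i, DifferentiableAt ℝ (fun y => conj (w y i)) y := fun y hy i =>
    Complex.conjCLE.differentiableAt.comp y (hdr y hy i)
  have hcomp : ∀ y ∈ S, ∀ i v, fderiv ℂ (fun y => w y i) y v = fderiv ℂ w y v i := by
    intro y hy i v
    rw [fderiv_apply ((hw y hy).differentiableAt (by simp))]
    rfl
  have h1 : (dzbar b fun y => ∑ i, ∑ j, w y i * H i j * conj (w y j)) =ᶠ[𝓝 z]
      fun y => ∑ i, ∑ j, w y i * H i j * conj (fderiv ℂ w y (e b) j) := by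
    filter_upwards [hS.mem_nhds hz] with y hy
    rw [dzbar_sum _ fun i _ => DifferentiableAt.fun_sum fun j _ =>
      ((hdr y hy i).mul_const _).fun_mul (hdc y hy j)]
    refine Finset.sum_congr rfl fun i _ => ?_
    rw [dzbar_sum _ fun j _ => ((hdr y hy i).mul_const _).fun_mul (hdc y hy j)]
    refine Finset.sum_congr rfl fun j _ => ?_
    rw [dzbar_mul ((hdr y hy i).mul_const _) (hdc y hy j),
      dzbar_of_differentiableAt ((hd y hy i).mul_const _), dzbar_conj (hdr y hy j),
      dz_of_differentiableAt (hd y hy j), hcomp y hy]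
    ring
  rw [dz_congr h1]
  have hdd : ∀ j, DifferentiableAt ℂ (fun y => fderiv ℂ w y (e b) j) z := fun j =>
    differentiableAt_pi.1 ((((hw z hz).fderiv_right (m := 1) (by simp)).differentiableAt
      (by simp)).clm_apply (differentiableAt_const _)) j
  have hddr : ∀ j, DifferentiableAt ℝ (fun y => fderiv ℂ w y (e b) j) z := fun j =>
    (hdd j).restrictScalars ℝ
  have hddc : ∀ j, DifferentiableAt ℝ (fun y => conj (fderiv ℂ w y (e b) j)) z := fun j =>
    Complex.conjCLE.differentiableAt.comp z (hddr j)
  rw [dz_sum _ fun i _ => DifferentiableAt.fun_sum fun j _ =>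
      ((hdr z hz i).mul_const _).fun_mul (hddc j)]
  refine Finset.sum_congr rfl fun i _ => ?_
  rw [dz_sum _ fun j _ => ((hdr z hz i).mul_const _).fun_mul (hddc j)]
  refine Finset.sum_congr rfl fun j _ => ?_
  rw [dz_mul ((hdr z hz i).mul_const _) (hddc j), dz_conj (hddr j),
    dzbar_of_differentiableAt (hdd j), dz_mul (hdr z hz i) (differentiableAt_const _), dz_const,
    dz_of_differentiableAt (hd z hz i), hcomp z hz]
  simp

variable {M : Type*} [TopologicalSpace M] [ChartedSpace (Cn n) M]
  [IsManifold 𝓘(ℂ, Cn n) ω M] {g : Metric n M} {φ ψ : OpenPartialHomeomorph M (Cn n)}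

theorem IsFlatChart.metricMatrix_eq (hg : IsKahler g) (hφ : IsFlatChart g φ) {z z' : Cn n}
    (hz : z ∈ φ.target) (hz' : z' ∈ φ.target) : metricMatrix g φ z = metricMatrix g φ z' := by
  ext a b
  rw [KahlerFrobenius.metricMatrix_eq hg hφ.mem hz, KahlerFrobenius.metricMatrix_eq hg hφ.mem hz',
    hφ.metricForm_eq z hz z' hz']

theorem metricMatrix_change (hg : IsKahler g) (hφ : φ ∈ holomorphicCharts n M)
    (hψ : ψ ∈ holomorphicCharts n M) {z : Cn n} (hz : z ∈ φ.target) (hz' : φ.symm z ∈ ψ.source)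
    (a b : Fin n) : metricMatrix g φ z a b =
      ∑ i, ∑ j, fderiv ℂ (ψ ∘ φ.symm) z (e a) i * metricMatrix g ψ (ψ (φ.symm z)) i j *
        conj (fderiv ℂ (ψ ∘ φ.symm) z (e b) j) := by
  have hr := ((contDiffAt_transition hφ hψ hz hz').differentiableAt (by simp)).fderiv_restrictScalars ℝ
  rw [← hermitianForm_eq_sum hg hψ (ψ.map_source hz'), hermitianForm_apply,
    metricMatrix_eq hg hφ hz, metricForm_change hφ hψ hz hz', metricForm_change hφ hψ hz hz', hr]
  simp

/-- Half the squared length of the position vector in the coordinates `φ`, with respect to the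
metric at the point with coordinates `z₀`. -/
def quadraticPotential (g : Metric n M) (φ : OpenPartialHomeomorph M (Cn n)) (z₀ : Cn n)
    (x : M) : ℝ :=
  metricForm g φ z₀ (φ x) (φ x) / 2

theorem quadraticPotential_eq (hg : IsKahler g) (hφ : φ ∈ holomorphicCharts n M) {z₀ : Cn n}
    (hz₀ : z₀ ∈ φ.target) (x : M) : (quadraticPotential g φ z₀ x : ℂ) =
      ∑ i, ∑ j, φ x i * metricMatrix g φ z₀ i j * conj (φ x j) := by
  rw [← hermitianForm_eq_sum hg hφ hz₀, hermitianForm_apply, quadraticPotential]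
  have h := metricForm_I_smul_left hg hφ hz₀ (φ x) (φ x)
  rw [metricForm_comm] at h
  -- `u` and `i u` are orthogonal, so the Hermitian form is real on the diagonal.
  have h0 : metricForm g φ z₀ (φ x) (Complex.I • φ x) = 0 := by linarith
  simp [h0]

/-- In any other holomorphic chart the potential is a Hermitian sum in the transition map; its mixed
second derivatives reproduce the transformation law of `g_{a b̄}`. -/
theorem IsFlatChart.isPotentialOn (hg : IsKahler g) (hψ : IsFlatChart g ψ) {z₀ : Cn n}
    (hz₀ : z₀ ∈ ψ.target) : IsPotentialOn g (quadraticPotential g ψ z₀) ψ.source where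
  smooth := by
    have h : ContDiff ℝ ∞ fun z : Cn n => metricForm g ψ z₀ z z / 2 :=
      (((metricForm g ψ z₀).toContinuousBilinearMap.contDiff.clm_apply contDiff_id).div_const 2 :)
    exact h.contMDiff.comp_contMDiffOn ((contMDiffOn_chart_real hψ.mem).of_le (by simp))
  metric_eq φ hφ z hz hzU a b := by
    set S := (φ.symm.trans ψ).source with hS
    have hmem : ∀ y, y ∈ S ↔ y ∈ φ.target ∧ φ.symm y ∈ ψ.source := fun y => by simp [hS]
    have hsum : inChart φ (quadraticPotential g ψ z₀) = fun y => ∑ i, ∑ j,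
        (ψ ∘ φ.symm) y i * metricMatrix g ψ z₀ i j * conj ((ψ ∘ φ.symm) y j) :=
      funext fun y => quadraticPotential_eq hg hψ.mem hz₀ (φ.symm y)
    have hw : ∀ y ∈ S, ContDiffAt ℂ ω (ψ ∘ φ.symm) y := fun y hy =>
      contDiffAt_transition hφ hψ.mem ((hmem y).1 hy).1 ((hmem y).1 hy).2
    rw [hsum, metricMatrix_change hg hφ hψ.mem hz hzU,
      hψ.metricMatrix_eq hg (ψ.map_source hzU) hz₀]
    exact (dz_dzbar_hermitian_sum (φ.symm.trans ψ).open_source hw (metricMatrix g ψ z₀)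
      ((hmem z).2 ⟨hz, hzU⟩) a b).symm

/-- In a flat chart `∂_b ∂_c̄ F = g_{b c̄}` is constant, whatever the potential. -/
theorem IsPotentialOn.dz_dz_dzbar_eq_zero {F : M → ℝ} {U : Set M} (hF : IsPotentialOn g F U)
    (hU : IsOpen U) (hg : IsKahler g) (hφ : IsFlatChart g φ) {z : Cn n} (hz : z ∈ φ.target)
    (hzU : φ.symm z ∈ U) (a b c : Fin n) : dz a (dz b (dzbar c (inChart φ F))) z = 0 := by
  have h : dz b (dzbar c (inChart φ F)) =ᶠ[𝓝 z] fun _ => metricMatrix g φ z b c := by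
    filter_upwards [φ.open_target.mem_nhds hz,
      (φ.continuousAt_symm hz).eventually_mem (hU.mem_nhds hzU)] with y hy hyU
    rw [← hF.metric_eq φ hφ.mem y hy hyU, hφ.metricMatrix_eq hg hy hz]
  rw [dz_congr h, dz_const]

end Potential
end KahlerFrobenius

end

/-! ### Assembly of the Frobenius structure. -/

open KahlerFrobenius in
/-- Since `X ∘ Y = ∇_X Y` vanishes for flat `Y`, and affine coordinate fields are flat, the
multiplication is necessarily zero. -/
theorem theoremT {n : ℕ} {M : Type*} [TopologicalSpace M] [T2Space M] [CompactSpace M]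
    [ChartedSpace (Cn n) M] [IsManifold 𝓘(ℂ, Cn n) ω M] (g : Metric n M)
    (hg : IsKahler g) (hR : HasVanishingCurvature g) :
    Nonempty (HermitianFrobeniusStructure g) := by
  obtain ⟨𝒜, h𝒜⟩ := exists_flat_affineStructure hg hR
  exact ⟨{
    kahler := hg
    affine := 𝒜
    cov := 𝒜.connection
    cov_smooth := HolomorphicAffineStructure.smooth_connection
    cov_flat := HolomorphicAffineStructure.isFlatConnection
    cov_torsion := HolomorphicAffineStructure.torsion_connection
    cov_compatible := HolomorphicAffineStructure.isCompatible_connection h𝒜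
    cov_affine := fun φ hφ v => HolomorphicAffineStructure.isFlatFieldOn_coordField hφ v
    mul := fun _ => 0
    mul_J := fun x X Y => by simp
    mul_holomorphic := fun φ _ u v => by
      refine (differentiableOn_const (𝕜 := ℂ) (s := φ.target) (0 : Cn n)).congr fun z _ => ?_
      exact map_zero (chartDeriv φ (φ.symm z))
    mul_comm := fun x X Y => rfl
    mul_assoc := fun x X Y Z => by simp
    mul_eq_cov := fun U X Y _ _ hY x hx => by simp [(hY x hx).2]
    A := fun _ => 0
    A_symm_left := fun x X Y Z => rfl
    A_symm_right := fun x X Y Z => rfl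
    A_eq_left := fun x X Y Z => by simp
    A_eq_right := fun x X Y Z => by simp
    potential := fun p => by
      obtain ⟨ψ, hψ, hp⟩ := 𝒜.cover p
      have hF := (h𝒜 ψ hψ).isPotentialOn hg (ψ.map_source hp)
      refine ⟨ψ.source, _, ψ.open_source, hp, hF, fun φ hφ z hz hzU => ⟨fun a b c => ?_, ?_⟩⟩
      · rw [hF.dz_dz_dzbar_eq_zero ψ.open_source hg (h𝒜 φ hφ) hz hzU]
        simp [holPart, antiPart]
      -- Each summand contains a vanishing factor: `Φ_{ab ē}` on the left and `Φ_{fa d̄}` on the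
      -- right.
      · intro a b c d
        simp [hF.dz_dz_dzbar_eq_zero ψ.open_source hg (h𝒜 φ hφ) hz hzU] }⟩
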